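/- Let $T>0$, $I=[-T,T]$, $n\ge 1$, let $D$ denote differentiation and $(\phi^*u)(t)=u(-t)$. Let $P(D)=\sum_{k=0}^n b_kD^k$ and $Q(D)=\sum_{k=0}^n a_kD^k$ be real polynomials with $a_n\neq\pm b_n$, and let $L=\phi^*P(D)+Q(D)$, that is, $Lu(t)=\sum_{k=0}^n a_ku^{(k)}(t)+\sum_{k=0}^n b_ku^{(k)}(-t)$ for $u\in W^{n,1}(I)$. Let $$B_ku=\sum_{j=0}^{n-1}\left[\alpha_{kj}u^{(j)}(-T)+\beta_{kj}u^{(j)}(T)\right],\qquad k=1,\dots,n,$$ be linearly independent two-point boundary conditions ($\alpha_{kj},\beta_{kj}\in\mathbb R$). Let $R$ be any real polynomial with $R(-D)=R(D)$ that divides $P$ and $Q$ (for instance $R=1$, or $R=\gcd(P(D),Q(D),P(-D),Q(-D))$ if this is even, or that gcd divided by $D$ if it is odd). Write $P=R\tilde P$, $Q=R\tilde Q$ and put $\widehat L=\phi^*\tilde P(D)-\tilde Q(-D)$, an operator of order $\ell=\max(\deg\tilde P,\deg\tilde Q)$. Then there is $S\in\mathbb R[D]$ such that $\widehat LL=L\widehat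 L=S$ on $W^{n+\ell,1}(I)$. Let $N$ be the order and $c_N$ the leading coefficient of $S$, and consider the reduced problem $$Sv=0,\qquad B_k\widehat Lv=0,\quad B_kv=0,\qquad k=1,\dots,n. \tag{1}$$ A Green's function of (1) is a function $G:I\times I\to\mathbb R$ such that $\partial_t^kG$ exists and is continuous on $I\times I$ for $k\le N-2$ and off the diagonal $t=s$ for $k\le N$, and such that for every $s\in(-T,T)$ the function $G(\cdot,s)$ satisfies $SG(\cdot,s)=0$ on $I\setminus\{s\}$ and the boundary conditions of (1), and $\partial_t^{N-1}G(\cdot,s)$ has one-sided limits at $s$ with $\partial_t^{N-1}G(s^+,s)-\partial_t^{N-1}G(s^-,s)=1/c_N$. Assume that $v=0$ is the only solution of (1) in $W^{N,1}(I)$. Then: 1. If $R$ is constant, or if $Sv=h$, $B_k\widehat Lv=0$, $B_kv=0$ ($k=1,\dots,n$) has a solution $v\in W^{N,1}(I)$ for every $h\in L^1(I)$, then (1) has a Green's function. Any two Green's functions of (1) agree at all $(t,s)$ with $t\in I$, $s\in(-T,T)$, $t\ne s$. 2. Let $G$ be the Green's function of (1) and $h\in L^1(I)$. Then the problem $$Lu(t)=h(t)\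 \text{ for a.e. } t\in I,\qquad B_ku=0,\quad k=1,\dots,n,$$ has exactly one solution $u\in W^{n,1}(I)$, and, for every $t\in I$, $$u(t)=\int_{-T}^{T}\widehat L_\vdash G(t,s)\,h(s)\,ds,$$ where $\widehat L_\vdash G(t,s)=\widehat L(G(\cdot,s))(t)$ and the integrand is integrable in $s$. -/

import Mathlib

open MeasureTheory Set Filter Topology Polynomial

noncomputable section

/-- The Sobolev space `W^{m,1}([-T,T])`, through its continuous representatives: integrable
functions for `m = 0`; for `m ≥ 1` functions of class `C^{m-1}` on `[-T,T]` whose derivative of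
order `m - 1` is absolutely continuous. Only the values on `[-T,T]` matter. -/
def MemW (T : ℝ) : ℕ → (ℝ → ℝ) → Prop
  | 0, u => IntegrableOn u (Icc (-T) T)
  | m + 1, u => ContDiffOn ℝ m u (Icc (-T) T) ∧
      AbsolutelyContinuousOnInterval (iteratedDerivWithin m u (Icc (-T) T)) (-T) T

/-- The operator `Q(D) = ∑ a_k D^k ∈ ℝ[D]` on functions on `[-T,T]`
(derivatives are one-sided at `±T`). -/
def diffOp (T : ℝ) (Q : ℝ[X]) (u : ℝ → ℝ) (t : ℝ) : ℝ :=
  Q.sum fun k a => a * iteratedDerivWithin k u (Icc (-T) T) t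

/-- The operator `φ^* P(D) + Q(D) ∈ ℝ[D, φ^*]`, where `(φ^* v)(t) = v(-t)`. -/
def reflOp (T : ℝ) (P Q : ℝ[X]) (u : ℝ → ℝ) (t : ℝ) : ℝ :=
  diffOp T P u (-t) + diffOp T Q u t

/-- For `L = φ^* P(D) + Q(D)` with `P = R P'`, `Q = R Q'`, the operator
`φ^* P'(D) - Q'(-D)`. -/
def hatOp (T : ℝ) (P' Q' : ℝ[X]) : (ℝ → ℝ) → ℝ → ℝ :=
  reflOp T P' (-(Q'.comp (-X)))

/-- The two-point boundary operator
`B_k u = ∑_{j < n} (α_{kj} u^{(j)}(-T) + β_{kj} u^{(j)}(T))`. -/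
def bdryOp {n : ℕ} (T : ℝ) (α β : Fin n → Fin n → ℝ) (k : Fin n) (u : ℝ → ℝ) : ℝ :=
  ∑ j : Fin n, (α k j * iteratedDerivWithin j u (Icc (-T) T) (-T) +
    β k j * iteratedDerivWithin j u (Icc (-T) T) T)

/-- `u ∈ W^{n,1}` solves `L u = h` a.e. on `[-T,T]`, `B_k u = 0` for all `k`,
where `L = φ^* P(D) + Q(D)`. -/
def IsReflSolution {n : ℕ} (T : ℝ) (P Q : ℝ[X]) (α β : Fin n → Fin n → ℝ) (h u : ℝ → ℝ) : Prop :=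
  MemW T n u ∧ (∀ᵐ t ∂volume.restrict (Icc (-T) T), reflOp T P Q u t = h t) ∧
    ∀ k, bdryOp T α β k u = 0

/-- `v` solves the boundary value problem `S v = h` a.e. on `[-T,T]`, `U_i v = 0` for all `i`,
in `W^{N,1}`, where `N` is the order of `S`. -/
def IsODESolution {ι : Type} (T : ℝ) (S : ℝ[X]) (U : ι → (ℝ → ℝ) → ℝ) (h v : ℝ → ℝ) : Prop :=
  MemW T S.natDegree v ∧ (∀ᵐ t ∂volume.restrict (Icc (-T) T), diffOp T S v t = h t) ∧
    ∀ i, U i v = 0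

/-- The `2 n` boundary conditions `B_k v = 0`, `B_k L̂ v = 0` of the reduced problem. -/
def reducedBdry {n : ℕ} (T : ℝ) (P' Q' : ℝ[X]) (α β : Fin n → Fin n → ℝ) :
    Fin n ⊕ Fin n → (ℝ → ℝ) → ℝ :=
  Sum.elim (fun k v => bdryOp T α β k v) (fun k v => bdryOp T α β k (hatOp T P' Q' v))

/-- `G` is a Green's function of the problem `S u = 0`, `U_i u = 0` on `[-T,T]`
(`S` of order `N` with leading coefficient `c_N`). -/
structure IsGreenFunction {ι : Type} (T : ℝ) (S : ℝ[X]) (U : ι → (ℝ → ℝ) → ℝ)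
    (G : ℝ → ℝ → ℝ) : Prop where
  /-- The `t`-derivatives of order at most `N - 2` exist on the whole square ... -/
  contDiffOn : ∀ k : ℕ, k + 2 ≤ S.natDegree → ∀ s ∈ Icc (-T) T,
    ContDiffOn ℝ k (fun t => G t s) (Icc (-T) T)
  /-- ... and are jointly continuous there. -/
  continuousOn : ∀ k : ℕ, k + 2 ≤ S.natDegree →
    ContinuousOn (fun p : ℝ × ℝ => iteratedDerivWithin k (fun t => G t p.2) (Icc (-T) T) p.1)
      (Icc (-T) T ×ˢ Icc (-T) T)
  /-- The `t`-derivatives of order at most `N` exist off the diagonal ... -/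
  contDiffOn_off : ∀ s ∈ Icc (-T) T,
    ContDiffOn ℝ S.natDegree (fun t => G t s) (Icc (-T) T \ {s})
  /-- ... and are jointly continuous there. -/
  continuousOn_off : ∀ k : ℕ, k ≤ S.natDegree →
    ContinuousOn (fun p : ℝ × ℝ => iteratedDerivWithin k (fun t => G t p.2) (Icc (-T) T) p.1)
      ((Icc (-T) T ×ˢ Icc (-T) T) \ {p | p.1 = p.2})
  /-- The `t`-derivative of order `N - 1` jumps by `1 / c_N` across the diagonal. -/
  jump : ∀ s ∈ Ioo (-T) T, ∃ a b : ℝ,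
    Tendsto (iteratedDerivWithin (S.natDegree - 1) (fun t => G t s) (Icc (-T) T))
      (𝓝[>] s) (𝓝 a) ∧
    Tendsto (iteratedDerivWithin (S.natDegree - 1) (fun t => G t s) (Icc (-T) T))
      (𝓝[<] s) (𝓝 b) ∧
    a - b = 1 / S.leadingCoeff
  /-- `G(·, s)` solves the homogeneous equation off `s`. -/
  eqn : ∀ s ∈ Ioo (-T) T, ∀ t ∈ Icc (-T) T, t ≠ s → diffOp T S (fun t => G t s) t = 0
  /-- `G(·, s)` satisfies the boundary conditions. -/
  bdry : ∀ s ∈ Ioo (-T) T, ∀ i, U i (fun t => G t s) = 0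

end

/-!
The operators `L = φ^* P(D) + Q(D)` and `L̂ = φ^* P'(D) - Q'(-D)` commute and their product is an
ordinary differential operator `S(D)`, because `D φ^* = -φ^* D` (`reflJet_mul_reflJet`). Its order is
`N = n + l`, where `l` is the order of `L̂` and `R` has degree `n - l`. Hence, if `v` solves
`S v = h`, `B_k v = 0`, `B_k L̂ v = 0`, then `u = L̂ v` solves `L u = h`, `B_k u = 0`.

Derivatives of functions of class `W^{m,1}` are handled through jets (`IsJet`): sequences of
functions, each a primitive of the next one. On jets all operators are given by the action of
`ℝ[X]` through the shift, together with the reflection, and composing them is algebra.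

For the equation `S v = h`, the exponential of the multiplication matrix of `ℝ[X]/(S)` provides a
fundamental system `E` with an explicit inverse of the Wronskian matrix
(`FundamentalSystem.nonempty`). On either side of the diagonal a Green's function is a combination of
`E`; the jump condition fixes the difference of the two combinations (`FundamentalSystem.impulse`),
and the boundary conditions say that the coordinates `c s` on the left solve the linear system
`M c = -b(s)`, with `M` the boundary values of the fundamental system and `b(s)` those of the impulse
(`IsGreenFunction.exists_eq_comb`). Uniqueness for the reduced problem means that `M` is injective,
so `c s` is determined through a left inverse of `M`; this gives uniqueness of the Green's function
and continuity of `c`. A Green's function exists as soon as `b(s)` lies in the range of `M`. For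
constant `R` the matrix `M` is square. In general, solvability for every `h` places the integrals
`∫ b(s) h(s) ds` in the range of `M`, and testing with suitable `h` gives `b(s)` itself
(`FundamentalSystem.rightBdryMap_impulse_mem_range`).

Integrating the explicit kernel against `h` yields the variation of constants formula
(`FundamentalSystem.duhamelJet`), which solves `S v = h` and the boundary conditions; applying `L̂`
under the integral gives a solution of the original problem for every `h`. Uniqueness is then a
dimension count (`eqOn_of_isReflSolution`): a solution of `L u = 0` is determined by its `n`
derivatives of order less than `n` at `0`, since `(u(t), u(-t))` solves a linear system, while
solvability makes the `n` independent conditions `B_k` map the kernel of `L` onto `ℝ^n`.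
-/

/-! ### Jets: functions of class `W^{m,1}` and their successive derivatives -/

/-- A jet of order `m` on `[-T,T]`: a sequence `w 0, w 1, …` of functions in which, up to the
order `m`, every function is integrable and is a primitive of the next one. The last function
`w m` thus matters only almost everywhere, and `w 0` is the general element of `W^{m,1}` together
with its derivatives. -/
structure IsJet (T : ℝ) (m : ℕ) (w : ℕ → ℝ → ℝ) : Prop where
  intervalIntegrable : ∀ k ≤ m, IntervalIntegrable (w k) volume (-T) T
  eq_integral : ∀ k < m, ∀ t ∈ Icc (-T) T, w k t = w k (-T) + ∫ x in (-T)..t, w (k + 1) x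

/-- A smooth jet: a sequence of functions on `ℝ`, each the derivative of the preceding one. -/
def IsSmoothJet (w : ℕ → ℝ → ℝ) : Prop :=
  ∀ k t, HasDerivAt (w k) (w (k + 1) t) t

section Chain

variable {s : Set ℝ} {w : ℕ → ℝ → ℝ} {u : ℝ → ℝ} {m : ℕ}

theorem iteratedDerivWithin_eq_of_chain (hs : UniqueDiffOn ℝ s) (hu : EqOn u (w 0) s)
    (hw : ∀ k < m, ∀ t ∈ s, HasDerivWithinAt (w k) (w (k + 1) t) s t) :
    ∀ k ≤ m, EqOn (iteratedDerivWithin k u s) (w k) s := by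
  intro k
  induction k with
  | zero => intro _ t ht; simpa using hu ht
  | succ k ih =>
    intro hk t ht
    have h1 := ih (by omega)
    rw [iteratedDerivWithin_succ, derivWithin_congr h1 (h1 ht)]
    exact (hw k (by omega) t ht).derivWithin (hs t ht)

theorem contDiffOn_of_chain (hs : UniqueDiffOn ℝ s) (hu : EqOn u (w 0) s)
    (hw : ∀ k < m, ∀ t ∈ s, HasDerivWithinAt (w k) (w (k + 1) t) s t)
    (hc : ContinuousOn (w m) s) : ContDiffOn ℝ m u s := by
  have h := iteratedDerivWithin_eq_of_chain hs hu hw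
  rw [contDiffOn_nat_iff_continuousOn_differentiableOn_deriv hs]
  refine ⟨fun k hk => ?_, fun k hk => ?_⟩
  · refine ContinuousOn.congr ?_ (h k hk)
    rcases hk.lt_or_eq with hk | rfl
    · exact fun t ht => (hw k hk t ht).continuousWithinAt
    · exact hc
  · exact DifferentiableOn.congr (fun t ht => (hw k hk t ht).differentiableWithinAt)
      (h k hk.le)

end Chain

theorem uniqueDiffOn_symm_Icc {T : ℝ} (hT : 0 < T) : UniqueDiffOn ℝ (Icc (-T) T) :=
  uniqueDiffOn_Icc (by linarith)

theorem IsSmoothJet.continuous {w : ℕ → ℝ → ℝ} (hw : IsSmoothJet w) (k : ℕ) :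
    Continuous (w k) :=
  continuous_iff_continuousAt.2 fun t => (hw k t).continuousAt

theorem IsSmoothJet.isJet {w : ℕ → ℝ → ℝ} (hw : IsSmoothJet w) (T : ℝ) (m : ℕ) :
    IsJet T m w where
  intervalIntegrable k _ := (hw.continuous k).intervalIntegrable _ _
  eq_integral k _ t _ := by
    rw [intervalIntegral.integral_eq_sub_of_hasDerivAt (fun x _ => hw k x)
      ((hw.continuous (k + 1)).intervalIntegrable _ _)]
    ring

theorem IsSmoothJet.iteratedDerivWithin_eq {w : ℕ → ℝ → ℝ} (hw : IsSmoothJet w) {s : Set ℝ}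
    (hs : UniqueDiffOn ℝ s) (k : ℕ) : EqOn (iteratedDerivWithin k (w 0) s) (w k) s :=
  iteratedDerivWithin_eq_of_chain (m := k) hs (fun _ _ => rfl)
    (fun k _ t _ => (hw k t).hasDerivWithinAt) k le_rfl

namespace IsJet

variable {T : ℝ} {m : ℕ} {w : ℕ → ℝ → ℝ} {u : ℝ → ℝ}

theorem mono (hw : IsJet T m w) {k : ℕ} (hk : k ≤ m) : IsJet T k w where
  intervalIntegrable j hj := hw.intervalIntegrable j (hj.trans hk)
  eq_integral j hj := hw.eq_integral j (hj.trans_le hk)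

theorem absolutelyContinuous (hw : IsJet T m w) {k : ℕ} (hk : k < m) :
    AbsolutelyContinuousOnInterval (fun t => w k (-T) + ∫ x in (-T)..t, w (k + 1) x) (-T) T := by
  refine AbsolutelyContinuousOnInterval.add (ContDiffOn.absolutelyContinuousOnInterval
    contDiffOn_const) ?_
  exact (hw.intervalIntegrable (k + 1) hk).absolutelyContinuousOnInterval_intervalIntegral
    left_mem_uIcc

theorem continuousOn (hT : 0 < T) (hw : IsJet T m w) {k : ℕ} (hk : k < m) :
    ContinuousOn (w k) (Icc (-T) T) := by
  have h := (hw.absolutelyContinuous hk).continuousOn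
  rw [uIcc_of_le (by linarith)] at h
  exact h.congr fun t ht => hw.eq_integral k hk t ht

/-- Where the next function is continuous, a function of a jet is differentiable in the
classical sense. -/
theorem hasDerivWithinAt_of_continuousOn (hT : 0 < T) (hw : IsJet T m w) {k : ℕ} (hk : k < m)
    {g : ℝ → ℝ} (hg : ContinuousOn g (Icc (-T) T))
    (hgw : ∀ᵐ t, t ∈ Icc (-T) T → w (k + 1) t = g t)
    {t : ℝ} (ht : t ∈ Icc (-T) T) : HasDerivWithinAt (w k) (g t) (Icc (-T) T) t := by
  have hle : -T ≤ T := by linarith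
  have key : ∀ t ∈ Icc (-T) T, w k t = w k (-T) + ∫ x in (-T)..t, g x := by
    intro t ht
    rw [hw.eq_integral k hk t ht]
    congr 1
    refine intervalIntegral.integral_congr_ae ?_
    filter_upwards [hgw] with x hx hx'
    rw [uIoc_of_le ht.1] at hx'
    exact hx ⟨hx'.1.le, hx'.2.trans ht.2⟩
  have hderiv : HasDerivWithinAt (fun t => w k (-T) + ∫ x in (-T)..t, g x) (g t)
      (Icc (-T) T) t := by
    refine HasDerivWithinAt.const_add _ ?_
    have hint : IntervalIntegrable g volume (-T) t := by
      refine ContinuousOn.intervalIntegrable (hg.mono ?_)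
      rw [uIcc_of_le ht.1]
      exact Icc_subset_Icc_right ht.2
    have : Fact (t ∈ Icc (-T) T) := ⟨ht⟩
    exact intervalIntegral.integral_hasDerivWithinAt_right hint
      (hg.stronglyMeasurableAtFilter_nhdsWithin measurableSet_Icc t) (hg t ht)
  exact hderiv.congr key (key t ht)

theorem hasDerivWithinAt (hT : 0 < T) (hw : IsJet T m w) {k : ℕ} (hk : k + 1 < m) {t : ℝ}
    (ht : t ∈ Icc (-T) T) : HasDerivWithinAt (w k) (w (k + 1) t) (Icc (-T) T) t :=
  hw.hasDerivWithinAt_of_continuousOn hT (by omega) (hw.continuousOn hT hk)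
    (Eventually.of_forall fun _ _ => rfl) ht

theorem ae_hasDerivWithinAt (hT : 0 < T) (hw : IsJet T m w) {k : ℕ} (hk : k < m) :
    ∀ᵐ t, t ∈ Icc (-T) T → HasDerivWithinAt (w k) (w (k + 1) t) (Icc (-T) T) t := by
  have hle : -T ≤ T := by linarith
  filter_upwards [(hw.intervalIntegrable (k + 1) hk).ae_hasDerivAt_integral] with t h ht
  have h' := h (by rwa [uIcc_of_le hle]) (-T) left_mem_uIcc
  exact (h'.const_add (w k (-T))).hasDerivWithinAt.congr (fun x hx => hw.eq_integral k hk x hx)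
    (hw.eq_integral k hk t ht)

theorem iteratedDerivWithin_eq (hT : 0 < T) (hw : IsJet T m w) (hu : EqOn u (w 0) (Icc (-T) T))
    {k : ℕ} (hk : k < m) : EqOn (iteratedDerivWithin k u (Icc (-T) T)) (w k) (Icc (-T) T) :=
  iteratedDerivWithin_eq_of_chain (uniqueDiffOn_symm_Icc hT) hu
    (fun _ hj _ ht => hw.hasDerivWithinAt hT (by omega) ht) k le_rfl

theorem ae_iteratedDerivWithin_eq (hT : 0 < T) (hw : IsJet T m w)
    (hu : EqOn u (w 0) (Icc (-T) T)) {k : ℕ} (hk : k ≤ m) :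
    ∀ᵐ t, t ∈ Icc (-T) T → iteratedDerivWithin k u (Icc (-T) T) t = w k t := by
  cases k with
  | zero => exact Eventually.of_forall fun t ht => by simpa using hu ht
  | succ k =>
    have h1 := hw.iteratedDerivWithin_eq hT hu (show k < m by omega)
    filter_upwards [hw.ae_hasDerivWithinAt hT (show k < m by omega)] with t h ht
    rw [iteratedDerivWithin_succ, derivWithin_congr h1 (h1 ht)]
    exact (h ht).derivWithin (uniqueDiffOn_symm_Icc hT t ht)

theorem memW (hT : 0 < T) (hw : IsJet T m w) (hu : EqOn u (w 0) (Icc (-T) T)) : MemW T m u := by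
  have hle : -T ≤ T := by linarith
  cases m with
  | zero =>
    have h := hw.intervalIntegrable 0 le_rfl
    rw [intervalIntegrable_iff_integrableOn_Icc_of_le hle] at h
    exact h.congr_fun hu.symm measurableSet_Icc
  | succ m =>
    refine ⟨contDiffOn_of_chain (uniqueDiffOn_symm_Icc hT) hu
      (fun k hk t ht => hw.hasDerivWithinAt hT (by omega) ht)
      (hw.continuousOn hT (Nat.lt_succ_self m)), ?_⟩
    have h := hw.absolutelyContinuous (Nat.lt_succ_self m)
    have he := hw.iteratedDerivWithin_eq hT hu (Nat.lt_succ_self m)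
    have hc : EqOn (iteratedDerivWithin m u (Icc (-T) T))
        (fun t => w m (-T) + ∫ x in (-T)..t, w (m + 1) x) (uIcc (-T) T) := by
      rw [uIcc_of_le hle]
      intro t ht
      rw [he ht]
      exact hw.eq_integral m (Nat.lt_succ_self m) t ht
    rw [absolutelyContinuousOnInterval_iff] at h ⊢
    intro ε hε
    obtain ⟨δ, hδ, H⟩ := h ε hε
    refine ⟨δ, hδ, fun E hE hlen => ?_⟩
    convert H E hE hlen using 1
    refine Finset.sum_congr rfl fun i hi => ?_
    have := hE.1 i hi
    rw [hc this.1, hc this.2]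

end IsJet

theorem MemW.isJet {T : ℝ} (hT : 0 < T) {m : ℕ} {u : ℝ → ℝ} (hu : MemW T m u) :
    IsJet T m fun k => iteratedDerivWithin k u (Icc (-T) T) := by
  have hle : -T ≤ T := by linarith
  have hU := uniqueDiffOn_symm_Icc hT
  cases m with
  | zero =>
    refine ⟨fun k hk => ?_, fun k hk => absurd hk (by omega)⟩
    obtain rfl : k = 0 := by omega
    simp only [iteratedDerivWithin_zero]
    rw [intervalIntegrable_iff_integrableOn_Icc_of_le hle]
    exact hu
  | succ m =>
    obtain ⟨hc, hac⟩ := hu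
    have hcont : ∀ k ≤ m, ContinuousOn (iteratedDerivWithin k u (Icc (-T) T)) (Icc (-T) T) :=
      fun k hk => hc.continuousOn_iteratedDerivWithin (by exact_mod_cast hk) hU
    have hder : ∀ f : ℝ → ℝ, ∀ t ∈ Ioo (-T) T, derivWithin f (Icc (-T) T) t = deriv f t :=
      fun f t ht => derivWithin_of_mem_nhds (Icc_mem_nhds ht.1 ht.2)
    have hae : ∀ᵐ t, t ∈ Icc (-T) T → derivWithin (iteratedDerivWithin m u (Icc (-T) T))
        (Icc (-T) T) t = deriv (iteratedDerivWithin m u (Icc (-T) T)) t := by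
      have h1 : ∀ᵐ t : ℝ, t ≠ -T := by simp [ae_iff, measure_singleton]
      have h2 : ∀ᵐ t : ℝ, t ≠ T := by simp [ae_iff, measure_singleton]
      filter_upwards [h1, h2] with t h1 h2 ht
      exact hder _ t ⟨lt_of_le_of_ne ht.1 (Ne.symm h1), lt_of_le_of_ne ht.2 h2⟩
    have hcongr : ∀ t ∈ Icc (-T) T, ∀ᵐ x, x ∈ uIoc (-T) t →
        deriv (iteratedDerivWithin m u (Icc (-T) T)) x =
          iteratedDerivWithin (m + 1) u (Icc (-T) T) x := by
      intro t ht
      filter_upwards [hae] with x hx hx'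
      rw [uIoc_of_le ht.1] at hx'
      rw [iteratedDerivWithin_succ, hx ⟨hx'.1.le, hx'.2.trans ht.2⟩]
    refine ⟨fun k hk => ?_, fun k hk t ht => ?_⟩
    · rcases Nat.lt_or_ge m k with h | h
      · obtain rfl : k = m + 1 := by omega
        refine hac.intervalIntegrable_deriv.congr_ae ?_
        exact (ae_restrict_iff' measurableSet_uIoc).2 (hcongr T ⟨hle, le_rfl⟩)
      · refine ContinuousOn.intervalIntegrable ?_
        rw [uIcc_of_le hle]
        exact hcont k h
    · rcases Nat.lt_or_ge k m with h | h
      · have hd : ∀ x ∈ Ioo (-T) t, HasDerivAt (iteratedDerivWithin k u (Icc (-T) T))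
            (iteratedDerivWithin (k + 1) u (Icc (-T) T) x) x := by
          intro x hx
          have hx' : x ∈ Ioo (-T) T := ⟨hx.1, hx.2.trans_le ht.2⟩
          have hn := Icc_mem_nhds hx'.1 hx'.2
          have h1 := (hc.differentiableOn_iteratedDerivWithin (by exact_mod_cast h) hU) x
            (Ioo_subset_Icc_self hx')
          have h2 := (h1.differentiableAt hn).hasDerivAt
          rwa [← hder _ x hx', ← iteratedDerivWithin_succ] at h2
        have hsub : Icc (-T) t ⊆ Icc (-T) T := Icc_subset_Icc_right ht.2
        rw [intervalIntegral.integral_eq_sub_of_hasDerivAt_of_le ht.1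
          ((hcont k h.le).mono hsub) hd]
        · ring
        · refine ContinuousOn.intervalIntegrable ?_
          rw [uIcc_of_le ht.1]
          exact (hcont (k + 1) h).mono hsub
      · obtain rfl : k = m := by omega
        have hac' := hac.mono (c := -T) (d := t) (by
          rw [uIcc_of_le ht.1, uIcc_of_le hle]; exact Icc_subset_Icc_right ht.2)
        rw [← intervalIntegral.integral_congr_ae (hcongr t ht), hac'.integral_deriv_eq_sub]
        ring

/-! ### The algebra of operators on jets -/

/-- Differentiation of jets. -/
def jetShift : (ℕ → ℝ → ℝ) →ₗ[ℝ] (ℕ → ℝ → ℝ) where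
  toFun w k := w (k + 1)
  map_add' _ _ := rfl
  map_smul' _ _ := rfl

/-- The jet of `φ^* u`, where `(φ^* u)(t) = u(-t)`. -/
def jetRefl : (ℕ → ℝ → ℝ) →ₗ[ℝ] (ℕ → ℝ → ℝ) where
  toFun w k t := (-1) ^ k * w k (-t)
  map_add' _ _ := by ext; simp [mul_add]
  map_smul' _ _ := by ext; simp; ring

/-- `φ^* P(D) + Q(D)` on jets. -/
noncomputable def reflJet (P Q : ℝ[X]) : (ℕ → ℝ → ℝ) →ₗ[ℝ] (ℕ → ℝ → ℝ) :=
  jetRefl * aeval jetShift P + aeval jetShift Q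

theorem jetShift_pow_apply (k : ℕ) (w : ℕ → ℝ → ℝ) (i : ℕ) (t : ℝ) :
    (jetShift ^ k) w i t = w (i + k) t := by
  induction k generalizing w with
  | zero => rfl
  | succ k ih => rw [pow_succ, Module.End.mul_apply, ih]; rfl

theorem aeval_jetShift_apply {P : ℝ[X]} {d : ℕ} (hP : P.natDegree ≤ d) (w : ℕ → ℝ → ℝ) (i : ℕ)
    (t : ℝ) : aeval jetShift P w i t = ∑ k ∈ Finset.range (d + 1), P.coeff k * w (i + k) t := by
  rw [aeval_eq_sum_range' (show P.natDegree < d + 1 by omega)]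
  simp [jetShift_pow_apply]

theorem jetRefl_apply (w : ℕ → ℝ → ℝ) (i : ℕ) (t : ℝ) :
    jetRefl w i t = (-1) ^ i * w i (-t) := rfl

theorem jetRefl_mul_jetRefl : jetRefl * jetRefl = 1 := by
  ext w i t
  simp [jetRefl_apply, ← mul_assoc, ← pow_add, ← two_mul]

/-- `P(D) φ^* = φ^* P(-D)`. -/
theorem aeval_jetShift_mul_jetRefl (P : ℝ[X]) :
    aeval jetShift P * jetRefl = jetRefl * aeval jetShift (P.comp (-X)) := by
  have hX : jetShift * jetRefl = jetRefl * -jetShift := by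
    ext w i t
    change (-1) ^ (i + 1) * w (i + 1) (-t) = (-1) ^ i * -(w (i + 1) (-t))
    ring
  rw [aeval_comp, map_neg, aeval_X]
  induction P using Polynomial.induction_on' with
  | add p q hp hq => rw [map_add, map_add, add_mul, mul_add, hp, hq]
  | monomial k a =>
    have hk : jetShift ^ k * jetRefl = jetRefl * (-jetShift) ^ k := by
      induction k with
      | zero => simp
      | succ k ih =>
        rw [pow_succ, mul_assoc, hX, ← mul_assoc, ih, mul_assoc, ← pow_succ]
    rw [aeval_monomial, aeval_monomial, mul_assoc, hk, ← mul_assoc,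
      (Algebra.commutes a jetRefl), mul_assoc]

/-- The composition `(φ^* P₁(D) + Q₁(D)) (φ^* P₂(D) + Q₂(D))`. -/
theorem reflJet_mul_reflJet (P₁ Q₁ P₂ Q₂ : ℝ[X]) :
    reflJet P₁ Q₁ * reflJet P₂ Q₂ =
      reflJet (P₁ * Q₂ + Q₁.comp (-X) * P₂) (P₁.comp (-X) * P₂ + Q₁ * Q₂) := by
  have h1 : jetRefl * aeval jetShift P₁ * (jetRefl * aeval jetShift P₂) =
      aeval jetShift (P₁.comp (-X) * P₂) := by
    rw [mul_assoc, ← mul_assoc (aeval jetShift P₁), aeval_jetShift_mul_jetRefl, ← mul_assoc,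
      ← mul_assoc, jetRefl_mul_jetRefl, one_mul, map_mul]
  have h2 : aeval jetShift Q₁ * (jetRefl * aeval jetShift P₂) =
      jetRefl * aeval jetShift (Q₁.comp (-X) * P₂) := by
    rw [← mul_assoc, aeval_jetShift_mul_jetRefl, map_mul, mul_assoc]
  simp only [reflJet, add_mul, mul_add, h1, h2, map_add, map_mul, mul_assoc]
  abel

theorem reflJet_zero_left (Q : ℝ[X]) : reflJet 0 Q = aeval jetShift Q := by
  simp [reflJet]

theorem natDegree_comp_neg_X (P : ℝ[X]) : (P.comp (-X)).natDegree = P.natDegree := by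
  simp [natDegree_comp]

namespace IsJet

variable {T : ℝ} {m : ℕ} {w w' : ℕ → ℝ → ℝ}

theorem add (hw : IsJet T m w) (hw' : IsJet T m w') (hT : 0 < T) : IsJet T m (w + w') where
  intervalIntegrable k hk := (hw.intervalIntegrable k hk).add (hw'.intervalIntegrable k hk)
  eq_integral k hk t ht := by
    have hsub : uIcc (-T) t ⊆ uIcc (-T) T := by
      rw [uIcc_of_le ht.1, uIcc_of_le (by linarith)]; exact Icc_subset_Icc_right ht.2
    simp only [Pi.add_apply]
    rw [intervalIntegral.integral_add ((hw.intervalIntegrable _ hk).mono_set hsub)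
      ((hw'.intervalIntegrable _ hk).mono_set hsub), hw.eq_integral k hk t ht,
      hw'.eq_integral k hk t ht]
    ring

theorem smul (hw : IsJet T m w) (c : ℝ) : IsJet T m (c • w) where
  intervalIntegrable k hk := (hw.intervalIntegrable k hk).const_mul c
  eq_integral k hk t ht := by
    simp only [Pi.smul_apply, smul_eq_mul]
    rw [intervalIntegral.integral_const_mul, hw.eq_integral k hk t ht]
    ring

theorem sub (hw : IsJet T m w) (hw' : IsJet T m w') (hT : 0 < T) : IsJet T m (w - w') := by
  have h := hw.add (hw'.smul (-1)) hT
  rwa [neg_one_smul, ← sub_eq_add_neg] at h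

theorem zero : IsJet T m 0 where
  intervalIntegrable k _ := by
    change IntervalIntegrable (fun _ => (0 : ℝ)) volume (-T) T
    simp
  eq_integral k _ t _ := by simp

theorem sum {ι : Type*} (s : Finset ι) {w : ι → ℕ → ℝ → ℝ} (hT : 0 < T)
    (hw : ∀ i ∈ s, IsJet T m (w i)) : IsJet T m (∑ i ∈ s, w i) :=
  Finset.sum_induction _ (IsJet T m) (fun _ _ h h' => h.add h' hT) zero hw

theorem shift_pow {j : ℕ} (hw : IsJet T (m + j) w) : IsJet T m ((jetShift ^ j) w) where
  intervalIntegrable k hk := by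
    have : (jetShift ^ j) w k = w (k + j) := funext fun t => jetShift_pow_apply j w k t
    rw [this]
    exact hw.intervalIntegrable _ (by omega)
  eq_integral k hk t ht := by
    simp only [jetShift_pow_apply]
    rw [show k + 1 + j = (k + j) + 1 by omega]
    exact hw.eq_integral (k + j) (by omega) t ht

theorem aeval {P : ℝ[X]} {d : ℕ} (hT : 0 < T) (hw : IsJet T (m + d) w) (hP : P.natDegree ≤ d) :
    IsJet T m (aeval jetShift P w) := by
  rw [aeval_eq_sum_range' (show P.natDegree < d + 1 by omega), LinearMap.sum_apply]
  refine sum _ hT fun k hk => ?_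
  rw [LinearMap.smul_apply]
  exact ((hw.mono (by simp at hk; omega)).shift_pow).smul _

theorem refl (hT : 0 < T) (hw : IsJet T m w) : IsJet T m (jetRefl w) where
  intervalIntegrable k hk := by
    have h := (IntervalIntegrable.iff_comp_neg (by finiteness)).1 (hw.intervalIntegrable k hk)
    rw [neg_neg] at h
    exact IntervalIntegrable.const_mul (IntervalIntegrable.symm h) ((-1) ^ k)
  eq_integral k hk t ht := by
    have hle : -T ≤ T := by linarith
    have ht' : -t ∈ Icc (-T) T := ⟨by linarith [ht.2], by linarith [ht.1]⟩
    simp only [jetRefl_apply, neg_neg]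
    rw [intervalIntegral.integral_const_mul,
      intervalIntegral.integral_comp_neg (fun x => w (k + 1) x), neg_neg,
      hw.eq_integral k hk (-t) ht', hw.eq_integral k hk T ⟨hle, le_rfl⟩]
    have hI := hw.intervalIntegrable (k + 1) hk
    have h1 : IntervalIntegrable (w (k + 1)) volume (-T) (-t) := hI.mono_set (by
      rw [uIcc_of_le ht'.1, uIcc_of_le hle]; exact Icc_subset_Icc_right ht'.2)
    have h2 : IntervalIntegrable (w (k + 1)) volume (-t) T := hI.mono_set (by
      rw [uIcc_of_le ht'.2, uIcc_of_le hle]; exact Icc_subset_Icc_left ht'.1)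
    rw [← intervalIntegral.integral_add_adjacent_intervals h1 h2]
    ring

theorem reflJet {P Q : ℝ[X]} {d : ℕ} (hT : 0 < T) (hw : IsJet T (m + d) w)
    (hw' : IsJet T (m + d) w') (hP : P.natDegree ≤ d) (hQ : Q.natDegree ≤ d) :
    IsJet T m (jetRefl (Polynomial.aeval jetShift P w) + Polynomial.aeval jetShift Q w') :=
  ((hw.aeval hT hP).refl hT).add (hw'.aeval hT hQ) hT

end IsJet

theorem reflJet_apply (P Q : ℝ[X]) (w : ℕ → ℝ → ℝ) :
    reflJet P Q w = jetRefl (aeval jetShift P w) + aeval jetShift Q w := rfl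

theorem reflJet_apply_zero (P Q : ℝ[X]) (w : ℕ → ℝ → ℝ) (t : ℝ) :
    reflJet P Q w 0 t = aeval jetShift P w 0 (-t) + aeval jetShift Q w 0 t := by
  simp [reflJet_apply, jetRefl_apply]

/-! ### Operators on functions, computed on jets -/

theorem diffOp_eq_aeval {T : ℝ} {P : ℝ[X]} {u : ℝ → ℝ} {w : ℕ → ℝ → ℝ} {t : ℝ}
    (h : ∀ k ≤ P.natDegree, iteratedDerivWithin k u (Icc (-T) T) t = w k t) :
    diffOp T P u t = aeval jetShift P w 0 t := by
  rw [aeval_jetShift_apply le_rfl, diffOp, sum_over_range _ (by simp)]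
  refine Finset.sum_congr rfl fun k hk => ?_
  rw [h k (by simp at hk; omega), zero_add]

theorem ae_comp_neg {T : ℝ} {p : ℝ → Prop} (h : ∀ᵐ t, t ∈ Icc (-T) T → p t) :
    ∀ᵐ t, t ∈ Icc (-T) T → p (-t) := by
  have h' := (Measure.measurePreserving_neg (volume : Measure ℝ)).quasiMeasurePreserving.ae h
  filter_upwards [h'] with t ht hm
  exact ht ⟨by linarith [hm.2], by linarith [hm.1]⟩

theorem neg_mem_symm_Icc {T t : ℝ} (ht : t ∈ Icc (-T) T) : -t ∈ Icc (-T) T :=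
  ⟨by linarith [ht.2], by linarith [ht.1]⟩

section

variable {T : ℝ} {m : ℕ} {w : ℕ → ℝ → ℝ} {u : ℝ → ℝ}

theorem IsJet.ae_diffOp_eq (hT : 0 < T) (hw : IsJet T m w) (hu : EqOn u (w 0) (Icc (-T) T))
    {P : ℝ[X]} (hP : P.natDegree ≤ m) :
    ∀ᵐ t, t ∈ Icc (-T) T → diffOp T P u t = Polynomial.aeval jetShift P w 0 t := by
  have h : ∀ᵐ t, ∀ k : ℕ, k ≤ m → t ∈ Icc (-T) T →
      iteratedDerivWithin k u (Icc (-T) T) t = w k t := by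
    rw [ae_all_iff]
    intro k
    by_cases hk : k ≤ m
    · filter_upwards [hw.ae_iteratedDerivWithin_eq hT hu hk] with t ht _ using ht
    · exact Eventually.of_forall fun _ h => absurd h hk
  filter_upwards [h] with t ht htI
  exact diffOp_eq_aeval fun k hk => ht k (hk.trans hP) htI

theorem IsJet.ae_reflOp_eq (hT : 0 < T) (hw : IsJet T m w) (hu : EqOn u (w 0) (Icc (-T) T))
    {P Q : ℝ[X]} (hP : P.natDegree ≤ m) (hQ : Q.natDegree ≤ m) :
    ∀ᵐ t, t ∈ Icc (-T) T → reflOp T P Q u t = _root_.reflJet P Q w 0 t := by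
  filter_upwards [ae_comp_neg (hw.ae_diffOp_eq hT hu hP), hw.ae_diffOp_eq hT hu hQ]
    with t h1 h2 ht
  rw [reflOp, h1 ht, h2 ht, reflJet_apply_zero]

end

/-! ### Boundary operators, computed on jets -/

section Boundary

variable {n : ℕ} (T : ℝ) (α β : Fin n → Fin n → ℝ)

/-- The boundary operators `B_k` evaluated on a function with jet `p.1` near `-T` and jet `p.2`
near `T`. -/
def bdryJet : ((ℕ → ℝ → ℝ) × (ℕ → ℝ → ℝ)) →ₗ[ℝ] (Fin n → ℝ) where
  toFun p k := ∑ j : Fin n, (α k j * p.1 j (-T) + β k j * p.2 j T)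
  map_add' p q := by
    ext k
    simp only [Prod.fst_add, Prod.snd_add, Pi.add_apply, ← Finset.sum_add_distrib]
    exact Finset.sum_congr rfl fun _ _ => by ring
  map_smul' c p := by
    ext k
    simp only [Prod.smul_fst, Prod.smul_snd, Pi.smul_apply, smul_eq_mul, RingHom.id_apply,
      Finset.mul_sum]
    exact Finset.sum_congr rfl fun _ _ => by ring

/-- The operator `φ^* P(D) + Q(D)` on functions given by one jet near `-T` and another near `T`:
the reflection exchanges the end points. -/
noncomputable def endReflJet (P Q : ℝ[X]) :
    ((ℕ → ℝ → ℝ) × (ℕ → ℝ → ℝ)) →ₗ[ℝ] ((ℕ → ℝ → ℝ) × (ℕ → ℝ → ℝ)) where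
  toFun p := (jetRefl (aeval jetShift P p.2) + aeval jetShift Q p.1,
    jetRefl (aeval jetShift P p.1) + aeval jetShift Q p.2)
  map_add' p q := by
    simp only [Prod.fst_add, Prod.snd_add, map_add, Prod.mk_add_mk]
    congr 1 <;> abel
  map_smul' c p := by
    simp only [Prod.smul_fst, Prod.smul_snd, map_smul, RingHom.id_apply, Prod.smul_mk, smul_add]

/-- The boundary conditions of the reduced problem, evaluated on a function with jet `p.1` near
`-T` and jet `p.2` near `T`. -/
noncomputable def reducedJet (P' Q' : ℝ[X]) :
    ((ℕ → ℝ → ℝ) × (ℕ → ℝ → ℝ)) →ₗ[ℝ] (Fin n ⊕ Fin n → ℝ) :=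
  (LinearEquiv.sumArrowLequivProdArrow (Fin n) (Fin n) ℝ ℝ).symm.toLinearMap ∘ₗ
    (bdryJet T α β).prod (bdryJet T α β ∘ₗ endReflJet P' (-(Q'.comp (-X))))

variable {T α β}

theorem bdryJet_apply (p : (ℕ → ℝ → ℝ) × (ℕ → ℝ → ℝ)) (k : Fin n) :
    bdryJet T α β p k = ∑ j : Fin n, (α k j * p.1 j (-T) + β k j * p.2 j T) := rfl

theorem reducedJet_inl (P' Q' : ℝ[X]) (p : (ℕ → ℝ → ℝ) × (ℕ → ℝ → ℝ)) (k : Fin n) :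
    reducedJet T α β P' Q' p (Sum.inl k) = bdryJet T α β p k := rfl

theorem reducedJet_inr (P' Q' : ℝ[X]) (p : (ℕ → ℝ → ℝ) × (ℕ → ℝ → ℝ)) (k : Fin n) :
    reducedJet T α β P' Q' p (Sum.inr k) =
      bdryJet T α β (endReflJet P' (-(Q'.comp (-X))) p) k := rfl

theorem bdryOp_eq (hT : 0 < T) {f g : ℕ → ℝ → ℝ} {v : ℝ → ℝ} (hf : IsJet T n f)
    (hg : IsJet T n g) (hvf : v =ᶠ[𝓝[Icc (-T) T] (-T)] f 0) (hvg : v =ᶠ[𝓝[Icc (-T) T] T] g 0)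
    (k : Fin n) : bdryOp T α β k v = bdryJet T α β (f, g) k := by
  have hl : -T ∈ Icc (-T) T := ⟨le_rfl, by linarith⟩
  have hr : T ∈ Icc (-T) T := ⟨by linarith, le_rfl⟩
  refine Finset.sum_congr rfl fun j _ => ?_
  rw [hvf.iteratedDerivWithin_eq (hvf.eq_of_nhdsWithin hl),
    hvg.iteratedDerivWithin_eq (hvg.eq_of_nhdsWithin hr),
    hf.iteratedDerivWithin_eq hT (fun _ _ => rfl) j.2 hl,
    hg.iteratedDerivWithin_eq hT (fun _ _ => rfl) j.2 hr]

theorem diffOp_eventuallyEq (hT : 0 < T) {m : ℕ} {f : ℕ → ℝ → ℝ} {v : ℝ → ℝ} (hf : IsJet T m f)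
    {a : ℝ} (hvf : v =ᶠ[𝓝[Icc (-T) T] a] f 0) {P : ℝ[X]} (hP : P.natDegree < m) :
    diffOp T P v =ᶠ[𝓝[Icc (-T) T] a] aeval jetShift P f 0 := by
  filter_upwards [eventually_eventually_nhdsWithin.2 hvf, self_mem_nhdsWithin] with x hx hxI
  have hx' : v =ᶠ[𝓝[Icc (-T) T] x] f 0 := hx
  refine diffOp_eq_aeval fun k hk => ?_
  rw [hx'.iteratedDerivWithin_eq (hx'.eq_of_nhdsWithin hxI),
    hf.iteratedDerivWithin_eq hT (fun _ _ => rfl) (by omega) hxI]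

theorem tendsto_neg_nhdsWithin_symm_Icc (a : ℝ) :
    Tendsto (fun t : ℝ => -t) (𝓝[Icc (-T) T] a) (𝓝[Icc (-T) T] (-a)) :=
  tendsto_nhdsWithin_of_tendsto_nhds_of_eventually_within _
    (continuous_neg.continuousAt.mono_left nhdsWithin_le_nhds)
    (eventually_nhdsWithin_of_forall fun _ ht => neg_mem_symm_Icc ht)

theorem reflOp_eventuallyEq (hT : 0 < T) {m : ℕ} {f g : ℕ → ℝ → ℝ} {v : ℝ → ℝ}
    (hf : IsJet T m f) (hg : IsJet T m g) {a : ℝ} (hvf : v =ᶠ[𝓝[Icc (-T) T] a] f 0)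
    (hvg : v =ᶠ[𝓝[Icc (-T) T] (-a)] g 0)
    {P Q : ℝ[X]} (hP : P.natDegree < m) (hQ : Q.natDegree < m) :
    reflOp T P Q v =ᶠ[𝓝[Icc (-T) T] a]
      (jetRefl (aeval jetShift P g) + aeval jetShift Q f) 0 := by
  filter_upwards [(tendsto_neg_nhdsWithin_symm_Icc a).eventually (diffOp_eventuallyEq hT hg hvg hP),
    diffOp_eventuallyEq hT hf hvf hQ] with t h1 h2
  simp [reflOp, h1, h2, jetRefl_apply]

theorem reducedBdry_eq (hT : 0 < T) (hn : 1 ≤ n) {P' Q' : ℝ[X]} {l : ℕ} (hP' : P'.natDegree ≤ l)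
    (hQ' : Q'.natDegree ≤ l) {f g : ℕ → ℝ → ℝ} {v : ℝ → ℝ} (hf : IsJet T (n + l) f)
    (hg : IsJet T (n + l) g) (hvf : v =ᶠ[𝓝[Icc (-T) T] (-T)] f 0)
    (hvg : v =ᶠ[𝓝[Icc (-T) T] T] g 0) (i : Fin n ⊕ Fin n) :
    reducedBdry T P' Q' α β i v = reducedJet T α β P' Q' (f, g) i := by
  have hQ'' : (-(Q'.comp (-X))).natDegree ≤ l := by rwa [natDegree_neg, natDegree_comp_neg_X]
  rcases i with k | k
  · exact bdryOp_eq hT (hf.mono (by omega)) (hg.mono (by omega)) hvf hvg k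
  · refine bdryOp_eq hT (hg.reflJet hT hf hP' hQ'') (hf.reflJet hT hg hP' hQ'') ?_ ?_ k
    · exact reflOp_eventuallyEq hT hf hg hvf (by rwa [neg_neg]) (by omega) (by omega)
    · exact reflOp_eventuallyEq hT hg hf hvg hvf (by omega) (by omega)

end Boundary

/-! ### Linear differential equations with constant coefficients -/

section MatrixExponential

variable {ι : Type*} [Fintype ι] [DecidableEq ι]

theorem hasDerivAt_matrix_exp_mul_apply (A B : Matrix ι ι ℝ) (i j : ι) (t : ℝ) :
    HasDerivAt (fun t : ℝ => (NormedSpace.exp (t • A) * B) i j)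
      ((NormedSpace.exp (t • A) * (A * B)) i j) t := by
  let _ : NormedRing (Matrix ι ι ℝ) := Matrix.linftyOpNormedRing
  let _ : NormedAlgebra ℝ (Matrix ι ι ℝ) := Matrix.linftyOpNormedAlgebra
  have h := (hasDerivAt_exp_smul_const A t).mul_const B
  rw [mul_assoc] at h
  have hL := (LinearMap.toContinuousLinearMap
    (Matrix.entryLinearMap ℝ ℝ i j : Matrix ι ι ℝ →ₗ[ℝ] ℝ)).hasFDerivAt.comp_hasDerivAt t h
  exact hL

end MatrixExponential

/-- A fundamental system of solutions of `S v = 0`, normalised at `0`. The solutions are `E l 0`,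
with derivatives `E l k`; the functions `ρ` are the entries of the inverse of the Wronskian
matrix. -/
structure FundamentalSystem (S : ℝ[X]) where
  E : Fin S.natDegree → ℕ → ℝ → ℝ
  ρ : Fin S.natDegree → Fin S.natDegree → ℝ → ℝ
  isSmoothJet : ∀ l, IsSmoothJet (E l)
  eqn : ∀ l, aeval jetShift S (E l) = 0
  init : ∀ l k : Fin S.natDegree, E l k 0 = if l = k then 1 else 0
  continuous_ρ : ∀ i j, Continuous (ρ i j)
  inverse : ∀ (i k : Fin S.natDegree) (s : ℝ), ∑ j, ρ i j s * E j k s = if i = k then 1 else 0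

/-- With `A` the matrix of multiplication by the root in `ℝ[X]/(S)`, the first column of `exp (t A)`
is a fundamental system of solutions. -/
theorem FundamentalSystem.nonempty {S : ℝ[X]} (hS : 0 < S.natDegree) :
    Nonempty (FundamentalSystem S) := by
  have hS0 : S ≠ 0 := by rintro rfl; simp at hS
  let b := AdjoinRoot.powerBasisAux hS0
  have hb : ∀ i : Fin S.natDegree, b i = AdjoinRoot.root S ^ (i : ℕ) := fun i =>
    (AdjoinRoot.powerBasis hS0).basis_eq_pow i
  let A : Matrix (Fin S.natDegree) (Fin S.natDegree) ℝ := Algebra.leftMulMatrix b (AdjoinRoot.root S)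
  let z : Fin S.natDegree := ⟨0, hS⟩
  have hA : ∀ l k : Fin S.natDegree, (A ^ (k : ℕ)) l z = if l = k then 1 else 0 := by
    intro l k
    rw [← map_pow, Algebra.leftMulMatrix_eq_repr_mul, hb z, pow_zero, mul_one, ← hb k,
      Module.Basis.repr_self, Finsupp.single_apply]
    simp only [eq_comm]
  have hAS : aeval A S = 0 := by
    have h := (Polynomial.aeval_algHom_apply (Algebra.leftMulMatrix b) (AdjoinRoot.root S) S)
    rw [h, AdjoinRoot.aeval_eq, AdjoinRoot.mk_self, map_zero]
  refine ⟨⟨fun l k t => (NormedSpace.exp (t • A) * A ^ k) l z,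
    fun i j s => (NormedSpace.exp ((-s) • A) : Matrix _ _ ℝ) i j, ?_, ?_, ?_, ?_, ?_⟩⟩
  · intro l k t
    simp only [pow_succ' A k]
    exact hasDerivAt_matrix_exp_mul_apply A (A ^ k) l z t
  · intro l
    ext i t
    rw [aeval_jetShift_apply le_rfl]
    have h : NormedSpace.exp (t • A) * A ^ i * aeval A S = 0 := by rw [hAS, mul_zero]
    rw [aeval_eq_sum_range, Finset.mul_sum] at h
    have h' := congrFun (congrFun h l) z
    rw [Matrix.sum_apply] at h'
    simp only [Pi.zero_apply]
    rw [Matrix.zero_apply] at h'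
    rw [← h']
    refine Finset.sum_congr rfl fun k _ => ?_
    rw [Algebra.mul_smul_comm, Matrix.smul_apply, smul_eq_mul, mul_assoc, pow_add]
  · intro l k
    simp only [zero_smul, NormedSpace.exp_zero, one_mul]
    exact hA l k
  · intro i j
    have h : Continuous fun s : ℝ => (NormedSpace.exp (s • A) : Matrix _ _ ℝ) i j := by
      have h1 := fun t => (hasDerivAt_matrix_exp_mul_apply A 1 i j t).continuousAt
      simp only [mul_one] at h1
      exact continuous_iff_continuousAt.2 h1
    exact h.comp continuous_neg
  · intro i k s
    rw [← Matrix.mul_apply, ← mul_assoc, ← Matrix.exp_add_of_commute, neg_smul, neg_add_cancel,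
      NormedSpace.exp_zero, one_mul]
    · exact hA i k
    · exact ((Commute.refl A).smul_left _).smul_right _

theorem eq_zero_of_linear_system {ι : Type*} [Fintype ι] {a b t₀ : ℝ} (ht₀ : t₀ ∈ Ioo a b)
    {x : ι → ℝ → ℝ}
    (hx : ∀ i, ∃ A : ι → ℝ, ∀ t ∈ Ioo a b, HasDerivAt (x i) (∑ j, A j * x j t) t)
    (h₀ : ∀ i, x i t₀ = 0) (i : ι) : ∀ t ∈ Ioo a b, x i t = 0 := by
  choose A hA using hx
  let F : (ι → ℝ) →L[ℝ] (ι → ℝ) := LinearMap.toContinuousLinearMap (Matrix.of A).mulVecLin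
  have hF : ∀ y i, F y i = ∑ j, A i j * y j := fun y i => by
    simp [F, Matrix.mulVec, dotProduct]
  have h := ODE_solution_unique_of_mem_Ioo (v := fun _ => F) (s := fun _ => univ) (K := ‖F‖₊)
    (f := fun t i => x i t) (g := fun _ => 0) (a := a) (b := b) (t₀ := t₀)
    (fun t _ => F.lipschitz.lipschitzOnWith) ht₀
    (fun t ht => ⟨hasDerivAt_pi.2 fun i => by rw [hF]; exact hA i t ht, mem_univ _⟩)
    (fun t _ => ⟨by simpa using hasDerivAt_const t (0 : ι → ℝ), mem_univ _⟩)
    (funext fun i => h₀ i)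
  exact fun t ht => congrFun (h ht) i

theorem eq_top_of_aeval_jetShift_eq_zero {S : ℝ[X]} (hS : S ≠ 0) {w : ℕ → ℝ → ℝ} {t : ℝ}
    (hw : aeval jetShift S w 0 t = 0) :
    w S.natDegree t = ∑ k : Fin S.natDegree, -(S.coeff k / S.leadingCoeff) * w k t := by
  have hc : S.leadingCoeff ≠ 0 := leadingCoeff_ne_zero.2 hS
  rw [aeval_jetShift_apply le_rfl, Finset.sum_range_succ, coeff_natDegree] at hw
  simp only [zero_add] at hw
  rw [Finset.sum_range] at hw
  rw [← mul_right_inj' hc, Finset.mul_sum, eq_neg_of_add_eq_zero_right hw, ← Finset.sum_neg_distrib]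
  refine Finset.sum_congr rfl fun k _ => ?_
  field_simp

theorem eq_zero_of_homogeneous {S : ℝ[X]} (hS : S ≠ 0) {a b t₀ : ℝ} (ht₀ : t₀ ∈ Ioo a b)
    {w : ℕ → ℝ → ℝ}
    (hw : ∀ k < S.natDegree, ∀ t ∈ Ioo a b, HasDerivAt (w k) (w (k + 1) t) t)
    (heq : ∀ t ∈ Ioo a b, aeval jetShift S w 0 t = 0) (h₀ : ∀ k < S.natDegree, w k t₀ = 0) :
    ∀ k < S.natDegree, ∀ t ∈ Ioo a b, w k t = 0 := by
  intro k hk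
  refine eq_zero_of_linear_system (x := fun i : Fin S.natDegree => w i) ht₀ ?_
    (fun i => h₀ i i.2) ⟨k, hk⟩
  intro i
  by_cases hi : (i : ℕ) + 1 < S.natDegree
  · refine ⟨Pi.single ⟨i + 1, hi⟩ 1, fun t ht => ?_⟩
    simpa [Pi.single_apply] using hw i i.2 t ht
  · refine ⟨fun k => -(S.coeff k / S.leadingCoeff), fun t ht => ?_⟩
    have h := hw i i.2 t ht
    rw [show (i : ℕ) + 1 = S.natDegree by omega,
      eq_top_of_aeval_jetShift_eq_zero hS (heq t ht)] at h
    exact h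

theorem IsSmoothJet.add {w w' : ℕ → ℝ → ℝ} (hw : IsSmoothJet w) (hw' : IsSmoothJet w') :
    IsSmoothJet (w + w') := fun k t => (hw k t).add (hw' k t)

theorem IsSmoothJet.smul {w : ℕ → ℝ → ℝ} (hw : IsSmoothJet w) (c : ℝ) :
    IsSmoothJet (c • w) := fun k t => (hw k t).const_smul c

theorem IsSmoothJet.sum {ι : Type*} (s : Finset ι) {w : ι → ℕ → ℝ → ℝ}
    (hw : ∀ i ∈ s, IsSmoothJet (w i)) : IsSmoothJet (∑ i ∈ s, w i) :=
  Finset.sum_induction _ IsSmoothJet (fun _ _ h h' => h.add h')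
    (fun _ t => hasDerivAt_const t (0 : ℝ)) hw

namespace FundamentalSystem

variable {S : ℝ[X]} (Φ : FundamentalSystem S)

/-- The jet of the solution of `S v = 0` with given coordinates in the fundamental system. -/
def comb : (Fin S.natDegree → ℝ) →ₗ[ℝ] (ℕ → ℝ → ℝ) := Fintype.linearCombination ℝ Φ.E

theorem comb_eq (c : Fin S.natDegree → ℝ) : Φ.comb c = ∑ l, c l • Φ.E l := rfl

theorem comb_apply (c : Fin S.natDegree → ℝ) (k : ℕ) (t : ℝ) :
    Φ.comb c k t = ∑ l, c l * Φ.E l k t := by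
  simp [comb_eq]

theorem isSmoothJet_comb (c : Fin S.natDegree → ℝ) : IsSmoothJet (Φ.comb c) := by
  rw [comb_eq]
  exact IsSmoothJet.sum _ fun l _ => (Φ.isSmoothJet l).smul _

theorem aeval_comb (c : Fin S.natDegree → ℝ) : aeval jetShift S (Φ.comb c) = 0 := by
  simp [comb_eq, Φ.eqn]

theorem comb_zero_point (c : Fin S.natDegree → ℝ) (k : Fin S.natDegree) :
    Φ.comb c k 0 = c k := by
  simp [comb_apply, Φ.init]

/-- Prescribed initial data at `s` are attained. -/
theorem comb_initial (η : Fin S.natDegree → ℝ) (s : ℝ) (k : Fin S.natDegree) :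
    Φ.comb (fun j => ∑ i, η i * Φ.ρ i j s) k s = η k := by
  simp only [comb_apply, Finset.sum_mul]
  rw [Finset.sum_comm]
  simp only [mul_assoc, ← Finset.mul_sum, Φ.inverse]
  simp

/-- A solution of `S v = 0` is determined by its initial data at `s`. -/
theorem comb_injective_at (hS : S ≠ 0) {c d : Fin S.natDegree → ℝ} (s : ℝ)
    (h : ∀ k : Fin S.natDegree, Φ.comb c k s = Φ.comb d k s) : c = d := by
  have hs : s ∈ Ioo (min s 0 - 1) (max s 0 + 1) :=
    ⟨by linarith [min_le_left s 0], by linarith [le_max_left s 0]⟩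
  have h0 : (0 : ℝ) ∈ Ioo (min s 0 - 1) (max s 0 + 1) :=
    ⟨by linarith [min_le_right s 0], by linarith [le_max_right s 0]⟩
  have key := eq_zero_of_homogeneous hS hs (w := Φ.comb (c - d))
    (fun k _ t _ => Φ.isSmoothJet_comb _ k t) (fun t _ => by rw [aeval_comb]; rfl)
    (fun k hk => by rw [map_sub]; simpa [sub_eq_zero] using h ⟨k, hk⟩)
  ext k
  have := key k k.2 0 h0
  rw [comb_zero_point] at this
  simpa [sub_eq_zero] using this

/-- Every classical solution of `S v = 0` on an open interval is a combination of the fundamental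
system. -/
theorem exists_comb_eq (hS : S ≠ 0) {a b : ℝ} {w : ℕ → ℝ → ℝ}
    (hw : ∀ k < S.natDegree, ∀ t ∈ Ioo a b, HasDerivAt (w k) (w (k + 1) t) t)
    (heq : ∀ t ∈ Ioo a b, aeval jetShift S w 0 t = 0) :
    ∃ c, ∀ k < S.natDegree, EqOn (w k) (Φ.comb c k) (Ioo a b) := by
  rcases (Ioo a b).eq_empty_or_nonempty with he | ⟨t₀, ht₀⟩
  · exact ⟨0, fun k _ => by rw [he]; exact eqOn_empty _ _⟩
  · refine ⟨fun j => ∑ i : Fin S.natDegree, w i t₀ * Φ.ρ i j t₀, fun k hk t ht => ?_⟩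
    set y := Φ.comb fun j => ∑ i : Fin S.natDegree, w i t₀ * Φ.ρ i j t₀ with hy
    have key := eq_zero_of_homogeneous hS ht₀ (w := w - y)
      (fun k hk t ht => (hw k hk t ht).sub (Φ.isSmoothJet_comb _ k t))
      (fun t ht => by
        rw [map_sub, hy, aeval_comb, sub_zero]; exact heq t ht)
      (fun k hk => by
        have := Φ.comb_initial (fun i => w i t₀) t₀ ⟨k, hk⟩
        simp only [Pi.sub_apply]
        rw [hy, this, sub_self])
    have := key k hk t ht
    simpa [sub_eq_zero] using this

/-- Every solution of `S v = 0` of class `W^{N,1}` is a combination of the fundamental system. -/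
theorem exists_comb_eq_of_isJet {T : ℝ} (hT : 0 < T) (hS : S ≠ 0) {w : ℕ → ℝ → ℝ}
    (hw : IsJet T S.natDegree w)
    (heq : ∀ᵐ t, t ∈ Icc (-T) T → aeval jetShift S w 0 t = 0) :
    ∃ c, ∀ k < S.natDegree, EqOn (w k) (Φ.comb c k) (Icc (-T) T) := by
  have hcont : ContinuousOn
      (fun t => ∑ k : Fin S.natDegree, -(S.coeff k / S.leadingCoeff) * w k t) (Icc (-T) T) :=
    continuousOn_finsetSum _ fun k _ => continuousOn_const.mul (hw.continuousOn hT k.2)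
  set g := fun t => ∑ k : Fin S.natDegree, -(S.coeff k / S.leadingCoeff) * w k t with hg
  -- The top derivative is only determined almost everywhere; the equation provides a continuous
  -- representative.
  set w' := Function.update w S.natDegree g with hw'
  have hlt : ∀ k < S.natDegree, w' k = w k := fun k hk => Function.update_of_ne hk.ne _ _
  have hN : w' S.natDegree = g := Function.update_self _ _ _
  have hder : ∀ k < S.natDegree, ∀ t ∈ Ioo (-T) T, HasDerivAt (w' k) (w' (k + 1) t) t := by
    intro k hk t ht
    rw [hlt k hk]
    have hn := Icc_mem_nhds ht.1 ht.2
    have htI := Ioo_subset_Icc_self ht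
    rcases Nat.lt_or_ge (k + 1) S.natDegree with h | h
    · rw [hlt _ h]
      exact (hw.hasDerivWithinAt hT h htI).hasDerivAt hn
    · obtain h : k + 1 = S.natDegree := by omega
      rw [h, hN]
      refine (hw.hasDerivWithinAt_of_continuousOn hT hk hcont ?_ htI).hasDerivAt hn
      filter_upwards [heq] with t h1 h2
      rw [h]
      exact eq_top_of_aeval_jetShift_eq_zero hS (h1 h2)
  have heq' : ∀ t ∈ Ioo (-T) T, aeval jetShift S w' 0 t = 0 := by
    intro t _
    have hc : S.leadingCoeff ≠ 0 := leadingCoeff_ne_zero.2 hS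
    rw [aeval_jetShift_apply le_rfl, Finset.sum_range_succ, coeff_natDegree]
    simp only [zero_add]
    rw [Finset.sum_range, hN, hg]
    simp only
    rw [Finset.mul_sum, ← Finset.sum_add_distrib]
    refine Finset.sum_eq_zero fun k _ => ?_
    rw [hlt k k.2]
    field_simp
    ring
  obtain ⟨c, hc⟩ := Φ.exists_comb_eq hS hder heq'
  refine ⟨c, fun k hk => ?_⟩
  have h := hc k hk
  rw [hlt k hk] at h
  refine h.of_subset_closure (hw.continuousOn hT hk)
    ((Φ.isSmoothJet_comb c).continuous k).continuousOn Ioo_subset_Icc_self ?_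
  rw [closure_Ioo (by linarith)]

end FundamentalSystem

/-! ### The reduced equation -/

/-- The polynomial `S` with `L̂ L = L L̂ = S(D)`. -/
noncomputable def reducedPoly (P Q P' Q' : ℝ[X]) : ℝ[X] :=
  P'.comp (-X) * P - Q'.comp (-X) * Q

section ReducedPoly

variable {P Q R P' Q' : ℝ[X]}

theorem coeff_comp_neg_X (A : ℝ[X]) (k : ℕ) : (A.comp (-X)).coeff k = (-1) ^ k * A.coeff k := by
  have h := comp_C_mul_X_coeff (p := A) (r := -1) (n := k)
  rw [C_neg, C_1, neg_one_mul] at h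
  rw [h, mul_comm]

theorem hat_mul_reflJet (hP' : P = R * P') (hQ' : Q = R * Q') :
    reflJet P' (-(Q'.comp (-X))) * reflJet P Q = aeval jetShift (reducedPoly P Q P' Q') := by
  rw [reflJet_mul_reflJet, ← reflJet_zero_left]
  congr 1
  · rw [neg_comp, comp_neg_X_comp_neg_X, hP', hQ']
    ring
  · rw [reducedPoly]
    ring

theorem reflJet_mul_hat (hR : R.comp (-X) = R) (hP' : P = R * P') (hQ' : Q = R * Q') :
    reflJet P Q * reflJet P' (-(Q'.comp (-X))) = aeval jetShift (reducedPoly P Q P' Q') := by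
  rw [reflJet_mul_reflJet, ← reflJet_zero_left]
  congr 1
  · rw [hP', hQ', mul_comp, hR]
    ring
  · rw [reducedPoly, hP', hQ', mul_comp, hR]
    ring

variable {n : ℕ}

theorem natDegree_add_max_eq (hP : P.natDegree ≤ n) (hQ : Q.natDegree ≤ n)
    (hPQ : Q.coeff n ^ 2 ≠ P.coeff n ^ 2) (hP' : P = R * P') (hQ' : Q = R * Q') :
    R.natDegree + max P'.natDegree Q'.natDegree = n := by
  have hR : R ≠ 0 := by
    rintro rfl
    simp [hP', hQ'] at hPQ
  have key : ∀ A A' : ℝ[X], A.natDegree ≤ n → A = R * A' →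
      (A' = 0 ∨ R.natDegree + A'.natDegree = A.natDegree) := by
    intro A A' _ hAA'
    by_cases h : A' = 0
    · exact Or.inl h
    · right
      rw [hAA', natDegree_mul hR h]
  have hcoeff : ∀ A : ℝ[X], A.natDegree ≤ n → A.coeff n ≠ 0 → A.natDegree = n := fun A h1 h2 =>
    le_antisymm h1 (le_natDegree_of_ne_zero h2)
  have h0 : P.coeff n ≠ 0 ∨ Q.coeff n ≠ 0 := by
    by_contra! h
    simp [h.1, h.2] at hPQ
  have hP0 := key P P' hP hP'
  have hQ0 := key Q Q' hQ hQ'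
  rcases h0 with h | h
  · have h1 := hcoeff P hP h
    have h2 : P' ≠ 0 := by rintro rfl; simp [hP'] at h
    have h3 := hP0.resolve_left h2
    rcases hQ0 with rfl | h4
    · simp only [natDegree_zero]; omega
    · omega
  · have h1 := hcoeff Q hQ h
    have h2 : Q' ≠ 0 := by rintro rfl; simp [hQ'] at h
    have h3 := hQ0.resolve_left h2
    rcases hP0 with rfl | h4
    · simp only [natDegree_zero]; omega
    · omega

theorem natDegree_reducedPoly (hP : P.natDegree ≤ n) (hQ : Q.natDegree ≤ n)
    (hPQ : Q.coeff n ^ 2 ≠ P.coeff n ^ 2) (hP' : P = R * P') (hQ' : Q = R * Q') :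
    (reducedPoly P Q P' Q').natDegree = n + max P'.natDegree Q'.natDegree := by
  have hdeg := natDegree_add_max_eq hP hQ hPQ hP' hQ'
  set l := max P'.natDegree Q'.natDegree with hl
  have hP'l : P'.natDegree ≤ l := le_max_left _ _
  have hQ'l : Q'.natDegree ≤ l := le_max_right _ _
  have hPn : P.coeff n = R.coeff R.natDegree * P'.coeff l := by
    rw [hP', ← hdeg]
    exact coeff_mul_add_eq_of_natDegree_le le_rfl hP'l
  have hQn : Q.coeff n = R.coeff R.natDegree * Q'.coeff l := by
    rw [hQ', ← hdeg]
    exact coeff_mul_add_eq_of_natDegree_le le_rfl hQ'l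
  have h1 : (P'.comp (-X)).natDegree ≤ l := by rwa [natDegree_comp_neg_X]
  have h2 : (Q'.comp (-X)).natDegree ≤ l := by rwa [natDegree_comp_neg_X]
  have hcoeff : (reducedPoly P Q P' Q').coeff (l + n) ≠ 0 := by
    rw [reducedPoly, coeff_sub, coeff_mul_add_eq_of_natDegree_le h1 hP,
      coeff_mul_add_eq_of_natDegree_le h2 hQ, coeff_comp_neg_X, coeff_comp_neg_X]
    intro h
    apply hPQ
    have h3 : ((-1 : ℝ) ^ l) ≠ 0 := by positivity
    have h4 : P'.coeff l * P.coeff n - Q'.coeff l * Q.coeff n = 0 := by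
      rw [← mul_right_inj' h3]
      linear_combination h
    have h5 : P.coeff n ^ 2 - Q.coeff n ^ 2 = 0 := by
      rw [pow_two, pow_two]
      nth_rewrite 1 [hPn]
      nth_rewrite 2 [hQn]
      linear_combination R.coeff R.natDegree * h4
    linarith
  refine le_antisymm ?_ (by rw [add_comm]; exact le_natDegree_of_ne_zero hcoeff)
  refine (natDegree_sub_le _ _).trans (max_le ?_ ?_)
  · exact natDegree_mul_le.trans (by omega)
  · exact natDegree_mul_le.trans (by omega)

end ReducedPoly

theorem reflOp_eq_reflJet (T : ℝ) (P Q : ℝ[X]) (u : ℝ → ℝ) :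
    reflOp T P Q u = reflJet P Q (fun k => iteratedDerivWithin k u (Icc (-T) T)) 0 := by
  ext t
  rw [reflJet_apply_zero, reflOp, diffOp_eq_aeval fun _ _ => rfl, diffOp_eq_aeval fun _ _ => rfl]

theorem IsJet.reflJet_of_le {T : ℝ} (hT : 0 < T) {m d : ℕ} {P Q : ℝ[X]} {w : ℕ → ℝ → ℝ}
    (hw : IsJet T (m + d) w) (hP : P.natDegree ≤ d) (hQ : Q.natDegree ≤ d) :
    IsJet T m (_root_.reflJet P Q w) :=
  hw.reflJet hT hw hP hQ

/-- `L̂ L = L L̂ = S(D)` almost everywhere on functions of class `W^{n+l,1}`. -/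
theorem MemW.hatOp_reflOp {T : ℝ} (hT : 0 < T) {n l : ℕ} {P Q R P' Q' : ℝ[X]}
    (hR : R.comp (-X) = R) (hP' : P = R * P') (hQ' : Q = R * Q') (hP : P.natDegree ≤ n)
    (hQ : Q.natDegree ≤ n) (hPl : P'.natDegree ≤ l) (hQl : Q'.natDegree ≤ l) {u : ℝ → ℝ}
    (hu : MemW T (n + l) u) :
    ∀ᵐ t ∂volume.restrict (Icc (-T) T),
      hatOp T P' Q' (reflOp T P Q u) t = diffOp T (reducedPoly P Q P' Q') u t ∧
      reflOp T P Q (hatOp T P' Q' u) t = diffOp T (reducedPoly P Q P' Q') u t := by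
  have hQl' : (-(Q'.comp (-X))).natDegree ≤ l := by rwa [natDegree_neg, natDegree_comp_neg_X]
  have hw := hu.isJet hT
  set w := fun k => iteratedDerivWithin k u (Icc (-T) T) with hwdef
  have h1 : IsJet T l (reflJet P Q w) := IsJet.reflJet_of_le hT (by rwa [add_comm]) hP hQ
  have h2 : IsJet T n (reflJet P' (-(Q'.comp (-X))) w) := IsJet.reflJet_of_le hT hw hPl hQl'
  have e1 := h1.ae_reflOp_eq hT (u := reflOp T P Q u)
    (fun t _ => by rw [reflOp_eq_reflJet]) hPl hQl'
  have e2 := h2.ae_reflOp_eq hT (u := hatOp T P' Q' u)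
    (fun t _ => by rw [hatOp, reflOp_eq_reflJet]) hP hQ
  rw [ae_restrict_iff' measurableSet_Icc]
  filter_upwards [e1, e2] with t h1 h2 ht
  rw [h2 ht, hatOp, h1 ht, ← Module.End.mul_apply, ← Module.End.mul_apply,
    hat_mul_reflJet hP' hQ', reflJet_mul_hat hR hP' hQ', diffOp_eq_aeval fun _ _ => rfl]
  exact ⟨rfl, rfl⟩

/-! ### Green's functions -/

/-- The boundary functionals `U` on functions of class `W^{N,1}` are given by the linear functionals
`V` of the jets at the two end points, and `V` only reads the values of the derivatives of order
less than `N` there. In particular `U` depends only on the germs at the end points. -/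
structure IsEndJetForm {ι : Type} (T : ℝ) (N : ℕ) (U : ι → (ℝ → ℝ) → ℝ)
    (V : ((ℕ → ℝ → ℝ) × (ℕ → ℝ → ℝ)) →ₗ[ℝ] (ι → ℝ)) : Prop where
  apply_eq : ∀ (v : ℝ → ℝ) (f g : ℕ → ℝ → ℝ), IsJet T N f → IsJet T N g →
    v =ᶠ[𝓝[Icc (-T) T] (-T)] f 0 → v =ᶠ[𝓝[Icc (-T) T] T] g 0 → ∀ i, U i v = V (f, g) i
  congr : ∀ f g f' g' : ℕ → ℝ → ℝ, (∀ k < N, f k (-T) = f' k (-T)) → (∀ k < N, g k T = g' k T) →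
    V (f, g) = V (f', g')

namespace FundamentalSystem

variable {S : ℝ[X]} (Φ : FundamentalSystem S)

/-- The coordinates of the solution of `S v = 0` whose derivatives at `s` vanish up to the order
`N - 2`, while the one of order `N - 1` is `1 / c_N`. -/
noncomputable def impulse (s : ℝ) (j : Fin S.natDegree) : ℝ :=
  ∑ i : Fin S.natDegree, (if (i : ℕ) + 1 = S.natDegree then 1 / S.leadingCoeff else 0) * Φ.ρ i j s

theorem comb_impulse (s : ℝ) {k : ℕ} (hk : k < S.natDegree) :
    Φ.comb (Φ.impulse s) k s = if k + 1 = S.natDegree then 1 / S.leadingCoeff else 0 :=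
  Φ.comb_initial (fun i => if (i : ℕ) + 1 = S.natDegree then 1 / S.leadingCoeff else 0) s ⟨k, hk⟩

theorem continuous_impulse : Continuous Φ.impulse :=
  continuous_pi fun j => continuous_finsetSum _ fun i _ =>
    continuous_const.mul (Φ.continuous_ρ i j)

variable {ι : Type} (V : ((ℕ → ℝ → ℝ) × (ℕ → ℝ → ℝ)) →ₗ[ℝ] (ι → ℝ))

/-- The boundary values of the solutions of `S v = 0`. -/
noncomputable def bdryMap : (Fin S.natDegree → ℝ) →ₗ[ℝ] (ι → ℝ) := V ∘ₗ Φ.comb.prod Φ.comb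

/-- The boundary values of functions that vanish near `-T` and solve `S v = 0` near `T`. -/
noncomputable def rightBdryMap : (Fin S.natDegree → ℝ) →ₗ[ℝ] (ι → ℝ) :=
  V ∘ₗ LinearMap.prod 0 Φ.comb

theorem apply_comb_comb_add (c d : Fin S.natDegree → ℝ) :
    V (Φ.comb c, Φ.comb (c + d)) = Φ.bdryMap V c + Φ.rightBdryMap V d := by
  simp [bdryMap, rightBdryMap, ← map_add]

variable {V}

theorem bdryMap_injective {T : ℝ} (hT : 0 < T) {U : ι → (ℝ → ℝ) → ℝ}
    (hUV : IsEndJetForm T S.natDegree U V)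
    (huniq : ∀ v : ℝ → ℝ, IsODESolution T S U 0 v → EqOn v 0 (Icc (-T) T)) :
    Function.Injective (Φ.bdryMap V) := by
  rw [injective_iff_map_eq_zero]
  intro c hc
  have hj := (Φ.isSmoothJet_comb c).isJet T S.natDegree
  have hsol : IsODESolution T S U 0 (Φ.comb c 0) := by
    refine ⟨hj.memW hT fun _ _ => rfl, ?_, fun i => ?_⟩
    · rw [ae_restrict_iff' measurableSet_Icc]
      filter_upwards [hj.ae_diffOp_eq hT (fun _ _ => rfl) le_rfl] with t h ht
      rw [h ht, aeval_comb]
      rfl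
    · rw [hUV.apply_eq _ _ _ hj hj EventuallyEq.rfl EventuallyEq.rfl]
      exact congrFun hc i
  have h0 := huniq _ hsol
  ext k
  have hz : (0 : ℝ) ∈ Icc (-T) T := ⟨by linarith, hT.le⟩
  have h1 := iteratedDerivWithin_congr (n := k) h0 hz
  rw [(Φ.isSmoothJet_comb c).iteratedDerivWithin_eq (uniqueDiffOn_symm_Icc hT) k hz,
    comb_zero_point] at h1
  rw [h1, iteratedDerivWithin_const_zero]
  rfl

end FundamentalSystem

section GreenStructure

variable {T : ℝ} {ι : Type} {S : ℝ[X]} {U : ι → (ℝ → ℝ) → ℝ} {G : ℝ → ℝ → ℝ}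

theorem IsGreenFunction.hasDerivWithinAt (hT : 0 < T) (hG : IsGreenFunction T S U G) {s : ℝ}
    (hs : s ∈ Icc (-T) T) {k : ℕ} (hk : k < S.natDegree) {t : ℝ} (ht : t ∈ Icc (-T) T)
    (hts : t ≠ s) :
    HasDerivWithinAt (iteratedDerivWithin k (fun t => G t s) (Icc (-T) T))
      (iteratedDerivWithin (k + 1) (fun t => G t s) (Icc (-T) T) t) (Icc (-T) T) t := by
  have hU := uniqueDiffOn_symm_Icc hT
  have h1 := hG.contDiffOn_off s hs t ⟨ht, hts⟩
  have h2 : ContDiffWithinAt ℝ S.natDegree (fun t => G t s) (Icc (-T) T) t :=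
    h1.mono_of_mem_nhdsWithin (inter_mem_nhdsWithin _ (isOpen_compl_singleton.mem_nhds hts))
  have h3 := h2.differentiableWithinAt_iteratedDerivWithin (m := k) (by exact_mod_cast hk)
    (by rwa [insert_eq_of_mem ht])
  rw [iteratedDerivWithin_succ]
  exact h3.hasDerivWithinAt

/-- On either side of the diagonal a Green's function solves `S v = 0`, and the two solutions differ
by the impulse at `s`; the boundary conditions then leave a linear system for the coordinates of
the solution on the left. -/
theorem IsGreenFunction.exists_eq_comb (hT : 0 < T) (hS : 0 < S.natDegree)
    (Φ : FundamentalSystem S) {V : ((ℕ → ℝ → ℝ) × (ℕ → ℝ → ℝ)) →ₗ[ℝ] (ι → ℝ)}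
    (hUV : IsEndJetForm T S.natDegree U V)
    (hG : IsGreenFunction T S U G) {s : ℝ} (hs : s ∈ Ioo (-T) T) :
    ∃ c, (∀ t ∈ Icc (-T) T, t < s → G t s = Φ.comb c 0 t) ∧
      (∀ t ∈ Icc (-T) T, s < t → G t s = Φ.comb (c + Φ.impulse s) 0 t) ∧
      Φ.bdryMap V c = -Φ.rightBdryMap V (Φ.impulse s) := by
  have hS0 : S ≠ 0 := by rintro rfl; simp at hS
  have hsI := Ioo_subset_Icc_self hs
  have hU := uniqueDiffOn_symm_Icc hT
  set w : ℕ → ℝ → ℝ := fun k => iteratedDerivWithin k (fun t => G t s) (Icc (-T) T) with hw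
  have hw0 : w 0 = fun t => G t s := by simp [hw]
  have hder : ∀ k < S.natDegree, ∀ t ∈ Icc (-T) T, t ≠ s →
      HasDerivWithinAt (w k) (w (k + 1) t) (Icc (-T) T) t := fun k hk t ht hts =>
    hG.hasDerivWithinAt hT hsI hk ht hts
  have heq : ∀ t ∈ Icc (-T) T, t ≠ s → aeval jetShift S w 0 t = 0 := fun t ht hts => by
    rw [← hG.eqn s hs t ht hts, diffOp_eq_aeval fun _ _ => rfl]
  have hL : ∀ t ∈ Ioo (-T) s, t ∈ Ioo (-T) T := fun t ht => ⟨ht.1, ht.2.trans hs.2⟩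
  have hR : ∀ t ∈ Ioo s T, t ∈ Ioo (-T) T := fun t ht => ⟨hs.1.trans ht.1, ht.2⟩
  obtain ⟨c, hc⟩ := Φ.exists_comb_eq hS0 (a := -T) (b := s) (w := w)
    (fun k hk t ht => (hder k hk t (Ioo_subset_Icc_self (hL t ht)) ht.2.ne).hasDerivAt
      (Icc_mem_nhds (hL t ht).1 (hL t ht).2))
    (fun t ht => heq t (Ioo_subset_Icc_self (hL t ht)) ht.2.ne)
  obtain ⟨d, hd⟩ := Φ.exists_comb_eq hS0 (a := s) (b := T) (w := w)
    (fun k hk t ht => (hder k hk t (Ioo_subset_Icc_self (hR t ht)) ht.1.ne').hasDerivAt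
      (Icc_mem_nhds (hR t ht).1 (hR t ht).2))
    (fun t ht => heq t (Ioo_subset_Icc_self (hR t ht)) ht.1.ne')
  have hcc : ∀ c k, Continuous (Φ.comb c k) := fun c k => (Φ.isSmoothJet_comb c).continuous k
  -- matching of the derivatives at `s`
  have hdiff : ∀ k : Fin S.natDegree, Φ.comb d k s = Φ.comb (c + Φ.impulse s) k s := by
    intro k
    rw [map_add, Pi.add_apply, Pi.add_apply, Φ.comb_impulse s k.2]
    split_ifs with hk
    · obtain ⟨a, b, ha, hb, hab⟩ := hG.jump s hs
      have hk' : S.natDegree - 1 = k := by omega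
      rw [hk'] at ha hb
      have ha' : Tendsto (w k) (𝓝[>] s) (𝓝 (Φ.comb d k s)) := by
        refine ((hcc d k).continuousAt.mono_left nhdsWithin_le_nhds : Tendsto _ (𝓝[>] s) _).congr' ?_
        filter_upwards [Ioo_mem_nhdsGT hs.2] with t ht
        exact (hd k k.2 ht).symm
      have hb' : Tendsto (w k) (𝓝[<] s) (𝓝 (Φ.comb c k s)) := by
        refine ((hcc c k).continuousAt.mono_left nhdsWithin_le_nhds : Tendsto _ (𝓝[<] s) _).congr' ?_
        filter_upwards [Ioo_mem_nhdsLT hs.1] with t ht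
        exact (hc k k.2 ht).symm
      have e1 := tendsto_nhds_unique ha ha'
      have e2 := tendsto_nhds_unique hb hb'
      rw [← e1, ← e2, ← hab]
      ring
    · have hk' : (k : ℕ) + 2 ≤ S.natDegree := by omega
      have hcont : ContinuousOn (w k) (Icc (-T) T) :=
        (hG.contDiffOn k hk' s hsI).continuousOn_iteratedDerivWithin le_rfl hU
      have e1 : EqOn (w k) (Φ.comb c k) (Icc (-T) s) :=
        (hc k k.2).of_subset_closure (hcont.mono (Icc_subset_Icc_right hs.2.le))
          (hcc c k).continuousOn Ioo_subset_Icc_self (by rw [closure_Ioo hs.1.ne])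
      have e2 : EqOn (w k) (Φ.comb d k) (Icc s T) :=
        (hd k k.2).of_subset_closure (hcont.mono (Icc_subset_Icc_left hs.1.le))
          (hcc d k).continuousOn Ioo_subset_Icc_self (by rw [closure_Ioo hs.2.ne])
      rw [add_zero, ← e1 ⟨hs.1.le, le_rfl⟩, ← e2 ⟨le_rfl, hs.2.le⟩]
  obtain rfl : d = c + Φ.impulse s := Φ.comb_injective_at hS0 s hdiff
  -- extension to the end points
  have hcontOff : ContinuousOn (w 0) (Icc (-T) T \ {s}) := fun t ht =>
    (hder 0 hS t ht.1 ht.2).continuousWithinAt.mono sdiff_subset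
  have eL : EqOn (w 0) (Φ.comb c 0) (Ico (-T) s) :=
    (hc 0 hS).of_subset_closure (hcontOff.mono fun t ht => ⟨⟨ht.1, (ht.2.trans hs.2).le⟩, ht.2.ne⟩)
      (hcc c 0).continuousOn Ioo_subset_Ico_self
      (by rw [closure_Ioo hs.1.ne]; exact Ico_subset_Icc_self)
  have eR : EqOn (w 0) (Φ.comb (c + Φ.impulse s) 0) (Ioc s T) :=
    (hd 0 hS).of_subset_closure
      (hcontOff.mono fun t ht => ⟨⟨(hs.1.trans ht.1).le, ht.2⟩, ht.1.ne'⟩)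
      (hcc _ 0).continuousOn Ioo_subset_Ioc_self
      (by rw [closure_Ioo hs.2.ne]; exact Ioc_subset_Icc_self)
  rw [hw0] at eL eR
  refine ⟨c, fun t ht hts => eL ⟨ht.1, hts⟩, fun t ht hts => eR ⟨hts, ht.2⟩, ?_⟩
  have hb := fun i => hUV.apply_eq (fun t => G t s) (Φ.comb c) (Φ.comb (c + Φ.impulse s))
    ((Φ.isSmoothJet_comb _).isJet T _) ((Φ.isSmoothJet_comb _).isJet T _)
    (by
      filter_upwards [self_mem_nhdsWithin, nhdsWithin_le_nhds (Iio_mem_nhds hs.1)] with t h1 h2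
      exact eL ⟨h1.1, h2⟩)
    (by
      filter_upwards [self_mem_nhdsWithin, nhdsWithin_le_nhds (Ioi_mem_nhds hs.2)] with t h1 h2
      exact eR ⟨h2, h1.2⟩) i
  rw [Φ.apply_comb_comb_add] at hb
  rw [eq_neg_iff_add_eq_zero]
  ext i
  rw [← hb i, hG.bdry s hs i]
  rfl

end GreenStructure

/-! ### Construction of the Green's function -/

theorem IsSmoothJet.contDiff {w : ℕ → ℝ → ℝ} (hw : IsSmoothJet w) (m : ℕ) :
    ContDiff ℝ m (w 0) :=
  contDiffOn_univ.1 (contDiffOn_of_chain uniqueDiffOn_univ (fun _ _ => rfl)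
    (fun k _ t _ => (hw k t).hasDerivWithinAt) (hw.continuous m).continuousOn)

section Glue

/-- The jet equal to `f` up to the point `s` and to `g` beyond it. -/
noncomputable def glueJet (f g : ℕ → ℝ → ℝ) (s : ℝ) (k : ℕ) (t : ℝ) : ℝ :=
  if s < t then g k t else f k t

variable {f g : ℕ → ℝ → ℝ} {s t : ℝ}

theorem glueJet_of_lt (h : s < t) (k : ℕ) : glueJet f g s k t = g k t := if_pos h

theorem glueJet_of_le (h : t ≤ s) (k : ℕ) : glueJet f g s k t = f k t := if_neg h.not_gt

theorem glueJet_eventuallyEq_right (h : s < t) (k : ℕ) : glueJet f g s k =ᶠ[𝓝 t] g k := by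
  filter_upwards [Ioi_mem_nhds h] with x hx using glueJet_of_lt hx k

theorem glueJet_eventuallyEq_left (h : t < s) (k : ℕ) : glueJet f g s k =ᶠ[𝓝 t] f k := by
  filter_upwards [Iio_mem_nhds h] with x hx using glueJet_of_le (le_of_lt hx) k

theorem hasDerivAt_glueJet_of_ne (hf : IsSmoothJet f) (hg : IsSmoothJet g) (hts : t ≠ s) (k : ℕ) :
    HasDerivAt (glueJet f g s k) (glueJet f g s (k + 1) t) t := by
  rcases lt_or_gt_of_ne hts with h | h
  · rw [glueJet_of_le h.le]
    exact (hf k t).congr_of_eventuallyEq (glueJet_eventuallyEq_left h k)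
  · rw [glueJet_of_lt h]
    exact (hg k t).congr_of_eventuallyEq (glueJet_eventuallyEq_right h k)

theorem hasDerivAt_glueJet_self (hf : IsSmoothJet f) (hg : IsSmoothJet g) {k : ℕ}
    (h0 : f k s = g k s) (h1 : f (k + 1) s = g (k + 1) s) :
    HasDerivAt (glueJet f g s k) (glueJet f g s (k + 1) s) s := by
  rw [glueJet_of_le le_rfl, ← hasDerivWithinAt_univ, ← Iic_union_Ici (a := s)]
  refine HasDerivWithinAt.union ?_ ?_
  · exact (hf k s).hasDerivWithinAt.congr (fun x hx => glueJet_of_le hx k)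
      (glueJet_of_le le_rfl k)
  · rw [h1]
    refine (hg k s).hasDerivWithinAt.congr (fun x hx => ?_) ((glueJet_of_le le_rfl k).trans h0)
    rcases (mem_Ici.1 hx).eq_or_lt with rfl | h
    · exact (glueJet_of_le le_rfl k).trans h0
    · exact glueJet_of_lt h k

variable {I : Set ℝ}

theorem iteratedDerivWithin_glueJet_of_ne (hI : UniqueDiffOn ℝ I) (hf : IsSmoothJet f)
    (hg : IsSmoothJet g) (ht : t ∈ I) (hts : t ≠ s) (k : ℕ) :
    iteratedDerivWithin k (glueJet f g s 0) I t = glueJet f g s k t := by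
  rcases lt_or_gt_of_ne hts with h | h
  · have he : glueJet f g s 0 =ᶠ[𝓝[I] t] f 0 :=
      (glueJet_eventuallyEq_left h 0).filter_mono nhdsWithin_le_nhds
    rw [he.iteratedDerivWithin_eq (he.eq_of_nhdsWithin ht), hf.iteratedDerivWithin_eq hI k ht,
      glueJet_of_le h.le]
  · have he : glueJet f g s 0 =ᶠ[𝓝[I] t] g 0 :=
      (glueJet_eventuallyEq_right h 0).filter_mono nhdsWithin_le_nhds
    rw [he.iteratedDerivWithin_eq (he.eq_of_nhdsWithin ht), hg.iteratedDerivWithin_eq hI k ht,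
      glueJet_of_lt h]

theorem hasDerivAt_glueJet (hf : IsSmoothJet f) (hg : IsSmoothJet g) {m : ℕ}
    (hfg : ∀ j ≤ m, f j s = g j s) {k : ℕ} (hk : k < m) (t : ℝ) :
    HasDerivAt (glueJet f g s k) (glueJet f g s (k + 1) t) t := by
  by_cases hts : t = s
  · subst hts
    exact hasDerivAt_glueJet_self hf hg (hfg k hk.le) (hfg (k + 1) hk)
  · exact hasDerivAt_glueJet_of_ne hf hg hts k

theorem iteratedDerivWithin_glueJet (hI : UniqueDiffOn ℝ I) (hf : IsSmoothJet f)
    (hg : IsSmoothJet g) {m : ℕ} (hfg : ∀ j ≤ m, f j s = g j s) {k : ℕ} (hk : k ≤ m) :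
    EqOn (iteratedDerivWithin k (glueJet f g s 0) I) (glueJet f g s k) I :=
  iteratedDerivWithin_eq_of_chain (m := m) hI (fun _ _ => rfl)
    (fun _ hk t _ => (hasDerivAt_glueJet hf hg hfg hk t).hasDerivWithinAt) k hk

theorem continuous_glueJet (hf : IsSmoothJet f) (hg : IsSmoothJet g) {k : ℕ}
    (hfg : f k s = g k s) : Continuous (glueJet f g s k) := by
  have h : glueJet f g s k = fun t => if t ≤ s then f k t else g k t := by
    ext t
    simp only [glueJet, ← not_le, ite_not]
  rw [h]
  exact (hf.continuous k).if_le (hg.continuous k) continuous_id continuous_const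
    (fun x hx => by obtain rfl : x = s := hx; exact hfg)

theorem contDiffOn_glueJet (hI : UniqueDiffOn ℝ I) (hf : IsSmoothJet f)
    (hg : IsSmoothJet g) {m : ℕ} (hfg : ∀ j ≤ m, f j s = g j s) :
    ContDiffOn ℝ m (glueJet f g s 0) I :=
  contDiffOn_of_chain hI (fun _ _ => rfl)
    (fun _ hk t _ => (hasDerivAt_glueJet hf hg hfg hk t).hasDerivWithinAt)
    (continuous_glueJet hf hg (hfg m le_rfl)).continuousOn

theorem contDiffAt_glueJet_of_ne (hf : IsSmoothJet f) (hg : IsSmoothJet g) (hts : t ≠ s) (m : ℕ) :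
    ContDiffAt ℝ m (glueJet f g s 0) t := by
  rcases lt_or_gt_of_ne hts with h | h
  · exact (hf.contDiff m).contDiffAt.congr_of_eventuallyEq (glueJet_eventuallyEq_left h 0)
  · exact (hg.contDiff m).contDiffAt.congr_of_eventuallyEq (glueJet_eventuallyEq_right h 0)

end Glue

namespace FundamentalSystem

variable {S : ℝ[X]} (Φ : FundamentalSystem S)

/-- The kernel that, as a function of the first argument, is the solution of `S v = 0` with
coordinates `c s` before `s` and receives the impulse at `s`; the natural number is the order of
differentiation. -/
noncomputable def kernelJet (c : ℝ → Fin S.natDegree → ℝ) (s : ℝ) : ℕ → ℝ → ℝ :=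
  glueJet (Φ.comb (c s)) (Φ.comb (c s + Φ.impulse s)) s

variable {Φ} {c : ℝ → Fin S.natDegree → ℝ}

theorem comb_eq_comb_add_impulse (s : ℝ) {j : ℕ} (hj : j + 2 ≤ S.natDegree) :
    Φ.comb (c s) j s = Φ.comb (c s + Φ.impulse s) j s := by
  rw [map_add, Pi.add_apply, Pi.add_apply, Φ.comb_impulse s (by omega), if_neg (by omega),
    add_zero]

theorem continuous_comb_uncurry {c : ℝ → Fin S.natDegree → ℝ} (hc : Continuous c) (k : ℕ) :
    Continuous fun p : ℝ × ℝ => Φ.comb (c p.2) k p.1 := by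
  simp only [comb_apply]
  refine continuous_finsetSum _ fun l _ => ?_
  exact ((continuous_apply l).comp (hc.comp continuous_snd)).mul
    (((Φ.isSmoothJet l).continuous k).comp continuous_fst)

theorem isGreenFunction_kernelJet {T : ℝ} (hT : 0 < T) (hS : 0 < S.natDegree) {ι : Type}
    {U : ι → (ℝ → ℝ) → ℝ} {V : ((ℕ → ℝ → ℝ) × (ℕ → ℝ → ℝ)) →ₗ[ℝ] (ι → ℝ)}
    (hUV : IsEndJetForm T S.natDegree U V) (hc : Continuous c)
    (hcV : ∀ s ∈ Ioo (-T) T, Φ.bdryMap V (c s) = -Φ.rightBdryMap V (Φ.impulse s)) :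
    IsGreenFunction T S U fun t s => Φ.kernelJet c s 0 t := by
  have hI := uniqueDiffOn_symm_Icc hT
  have hsm := Φ.isSmoothJet_comb
  have hc' : Continuous fun s => c s + Φ.impulse s := hc.add Φ.continuous_impulse
  have hfg : ∀ (k : ℕ), k + 2 ≤ S.natDegree → ∀ s, ∀ j ≤ k,
      Φ.comb (c s) j s = Φ.comb (c s + Φ.impulse s) j s := fun k hk s j hj =>
    comb_eq_comb_add_impulse s (by omega)
  refine ⟨fun k hk s _ => ?_, fun k hk => ?_, fun s _ t ht => ?_, fun k _ => ?_, fun s hs => ?_,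
    fun s _ t ht hts => ?_, fun s hs i => ?_⟩
  · exact contDiffOn_glueJet hI (hsm _) (hsm _) (hfg k hk s)
  · have h : Continuous fun p : ℝ × ℝ => Φ.kernelJet c p.2 k p.1 := by
      have h : (fun p : ℝ × ℝ => Φ.kernelJet c p.2 k p.1) = fun p : ℝ × ℝ =>
          if p.1 ≤ p.2 then Φ.comb (c p.2) k p.1 else Φ.comb (c p.2 + Φ.impulse p.2) k p.1 := by
        ext p
        simp only [kernelJet, glueJet, ← not_le, ite_not]
      rw [h]
      refine (continuous_comb_uncurry hc k).if_le (continuous_comb_uncurry hc' k) continuous_fst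
        continuous_snd fun p hp => ?_
      rw [hp]
      exact comb_eq_comb_add_impulse p.2 hk
    exact h.continuousOn.congr fun p hp =>
      iteratedDerivWithin_glueJet hI (hsm _) (hsm _) (hfg k hk p.2) le_rfl hp.1
  · exact (contDiffAt_glueJet_of_ne (hsm _) (hsm _) ht.2 _).contDiffWithinAt
  · have h : ContinuousOn (fun p : ℝ × ℝ => Φ.kernelJet c p.2 k p.1)
        ((Icc (-T) T ×ˢ Icc (-T) T) \ {p | p.1 = p.2}) := by
      rintro p ⟨-, hp⟩
      refine ContinuousAt.continuousWithinAt ?_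
      rcases lt_or_gt_of_ne hp with h | h
      · refine (continuous_comb_uncurry (Φ := Φ) hc k).continuousAt.congr ?_
        filter_upwards [(isOpen_lt continuous_fst continuous_snd).mem_nhds h] with q hq
        exact (glueJet_of_le (le_of_lt hq) k).symm
      · refine (continuous_comb_uncurry (Φ := Φ) hc' k).continuousAt.congr ?_
        filter_upwards [(isOpen_lt continuous_snd continuous_fst).mem_nhds h] with q hq
        exact (glueJet_of_lt hq k).symm
    exact h.congr fun p hp => iteratedDerivWithin_glueJet_of_ne hI (hsm _) (hsm _) hp.1.1 hp.2 k
  · refine ⟨Φ.comb (c s + Φ.impulse s) (S.natDegree - 1) s, Φ.comb (c s) (S.natDegree - 1) s,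
      ?_, ?_, ?_⟩
    · refine (((hsm _).continuous _).continuousAt.mono_left nhdsWithin_le_nhds :
        Tendsto _ (𝓝[>] s) _).congr' ?_
      filter_upwards [Ioo_mem_nhdsGT hs.2] with t ht
      exact ((iteratedDerivWithin_glueJet_of_ne hI (hsm _) (hsm _) ⟨(hs.1.trans ht.1).le, ht.2.le⟩
        ht.1.ne' _).trans (glueJet_of_lt ht.1 _)).symm
    · refine (((hsm _).continuous _).continuousAt.mono_left nhdsWithin_le_nhds :
        Tendsto _ (𝓝[<] s) _).congr' ?_
      filter_upwards [Ioo_mem_nhdsLT hs.1] with t ht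
      exact ((iteratedDerivWithin_glueJet_of_ne hI (hsm _) (hsm _) ⟨ht.1.le, (ht.2.trans hs.2).le⟩
        ht.2.ne _).trans (glueJet_of_le ht.2.le _)).symm
    · rw [map_add, Pi.add_apply, Pi.add_apply, add_sub_cancel_left,
        Φ.comb_impulse s (by omega), if_pos (by omega)]
  · change diffOp T S (glueJet (Φ.comb (c s)) (Φ.comb (c s + Φ.impulse s)) s 0) t = 0
    rw [diffOp_eq_aeval fun k _ => iteratedDerivWithin_glueJet_of_ne hI (hsm _) (hsm _) ht hts k]
    rcases lt_or_gt_of_ne hts with h | h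
    · have := congrFun (congrFun (Φ.aeval_comb (c s)) 0) t
      rw [aeval_jetShift_apply le_rfl] at this ⊢
      simpa only [glueJet_of_le h.le, Pi.zero_apply] using this
    · have := congrFun (congrFun (Φ.aeval_comb (c s + Φ.impulse s)) 0) t
      rw [aeval_jetShift_apply le_rfl] at this ⊢
      simpa only [glueJet_of_lt h, Pi.zero_apply] using this
  · change U i (glueJet (Φ.comb (c s)) (Φ.comb (c s + Φ.impulse s)) s 0) = 0
    rw [hUV.apply_eq _ (Φ.comb (c s)) (Φ.comb (c s + Φ.impulse s)) ((hsm _).isJet T _)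
      ((hsm _).isJet T _)
      ((glueJet_eventuallyEq_left hs.1 0).filter_mono nhdsWithin_le_nhds)
      ((glueJet_eventuallyEq_right hs.2 0).filter_mono nhdsWithin_le_nhds),
      Φ.apply_comb_comb_add, hcV s hs, neg_add_cancel]
    rfl

end FundamentalSystem

/-! ### The inhomogeneous equation -/

section Integrals

variable {a b : ℝ} {h : ℝ → ℝ}

/-- The product rule, integrated, for a smooth function and a primitive of an integrable one. -/
theorem mul_integral_eq_integral {e e' g : ℝ → ℝ} (he : ∀ t, HasDerivAt e (e' t) t)
    (he' : Continuous e') (hg : IntervalIntegrable g volume a b) :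
    e b * ∫ x in a..b, g x = ∫ x in a..b, (e' x * (∫ y in a..x, g y) + e x * g x) := by
  have hd : deriv e = e' := funext fun t => (he t).deriv
  have hC : ContDiff ℝ 1 e := contDiff_one_iff_deriv.2 ⟨fun t => (he t).differentiableAt, hd ▸ he'⟩
  have h1 : AbsolutelyContinuousOnInterval e a b :=
    ContDiffOn.absolutelyContinuousOnInterval hC.contDiffOn
  have h2 : AbsolutelyContinuousOnInterval (fun x => ∫ y in a..x, g y) a b :=
    hg.absolutelyContinuousOnInterval_intervalIntegral left_mem_uIcc
  have h3 := h1.integral_deriv_mul_eq_sub h2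
  simp only [intervalIntegral.integral_same, mul_zero, sub_zero] at h3
  rw [← h3]
  refine intervalIntegral.integral_congr_ae ?_
  filter_upwards [hg.ae_hasDerivAt_integral] with x hx hxI
  rw [hd, (hx (uIoc_subset_uIcc hxI) a left_mem_uIcc).deriv]

variable {ι : Type*}

theorem intervalIntegrable_coord_mul {κ : ℝ → ι → ℝ} (hκ : Continuous κ)
    (hh : IntervalIntegrable h volume a b) (l : ι) :
    IntervalIntegrable (fun s => κ s l * h s) volume a b :=
  hh.continuousOn_mul ((continuous_apply l).comp hκ).continuousOn

theorem LinearMap.apply_eq_sum_single [Fintype ι] [DecidableEq ι] (Λ : (ι → ℝ) →ₗ[ℝ] ℝ)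
    (x : ι → ℝ) : Λ x = ∑ l, x l * Λ (Pi.single l 1) := by
  rw [LinearMap.pi_apply_eq_sum_univ Λ x]
  refine Finset.sum_congr rfl fun l _ => ?_
  rw [smul_eq_mul]
  congr 2
  ext j
  simp [Pi.single_apply, eq_comm]

theorem LinearMap.integral_coord_mul [Fintype ι] (Λ : (ι → ℝ) →ₗ[ℝ] ℝ) {κ : ℝ → ι → ℝ} (hκ : Continuous κ)
    (hh : IntervalIntegrable h volume a b) :
    Λ (fun l => ∫ s in a..b, κ s l * h s) = ∫ s in a..b, Λ (κ s) * h s := by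
  classical
  have hΛ := Λ.apply_eq_sum_single
  have h1 : ∀ s, Λ (κ s) * h s = ∑ l, Λ (Pi.single l 1) * (κ s l * h s) := fun s => by
    rw [hΛ (κ s), Finset.sum_mul]
    exact Finset.sum_congr rfl fun l _ => by ring
  simp only [h1]
  rw [intervalIntegral.integral_finsetSum fun l _ =>
    (intervalIntegrable_coord_mul hκ hh l).const_mul _, hΛ]
  refine Finset.sum_congr rfl fun l _ => ?_
  rw [intervalIntegral.integral_const_mul, mul_comm]

end Integrals

namespace FundamentalSystem

variable {S : ℝ[X]} (Φ : FundamentalSystem S) (T : ℝ) (h : ℝ → ℝ)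

/-- The coordinates accumulated between `-T` and `t` under the action of `h`. -/
noncomputable def accum (t : ℝ) (l : Fin S.natDegree) : ℝ :=
  ∫ s in (-T)..t, Φ.impulse s l * h s

/-- The solution of `S v = h` whose derivatives at `-T` of order less than `N` are those of the
homogeneous solution with coordinates `d`, by variation of constants. -/
noncomputable def duhamelJet (d : Fin S.natDegree → ℝ) (k : ℕ) (t : ℝ) : ℝ :=
  Φ.comb (d + Φ.accum T h t) k t + if k = S.natDegree then h t / S.leadingCoeff else 0

variable {Φ T h} {d : Fin S.natDegree → ℝ}

theorem duhamelJet_of_lt {k : ℕ} (hk : k < S.natDegree) (t : ℝ) :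
    Φ.duhamelJet T h d k t = Φ.comb (d + Φ.accum T h t) k t := by
  rw [duhamelJet, if_neg hk.ne, add_zero]

theorem intervalIntegrable_impulse_mul (hh : IntervalIntegrable h volume (-T) T)
    (l : Fin S.natDegree) : IntervalIntegrable (fun s => Φ.impulse s l * h s) volume (-T) T :=
  intervalIntegrable_coord_mul Φ.continuous_impulse hh l

theorem continuousOn_accum (hh : IntervalIntegrable h volume (-T) T)
    (l : Fin S.natDegree) : ContinuousOn (fun t => Φ.accum T h t l) (uIcc (-T) T) := by
  have h1 := intervalIntegrable_impulse_mul (Φ := Φ) hh l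
  exact (h1.absolutelyContinuousOnInterval_intervalIntegral left_mem_uIcc).continuousOn

theorem isJet_duhamelJet (hT : 0 < T) (hh : IntervalIntegrable h volume (-T) T) :
    IsJet T S.natDegree (Φ.duhamelJet T h d) := by
  have hle : -T ≤ T := by linarith
  have hcomb : ∀ k, ContinuousOn (fun t => Φ.comb (d + Φ.accum T h t) k t) (uIcc (-T) T) := by
    intro k
    simp only [comb_apply]
    refine continuousOn_finsetSum _ fun l _ => ContinuousOn.mul ?_
      ((Φ.isSmoothJet l).continuous k).continuousOn
    exact continuousOn_const.add (continuousOn_accum hh l)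
  refine ⟨fun k _ => ?_, fun k hk t ht => ?_⟩
  · refine (hcomb k).intervalIntegrable.add ?_
    split_ifs
    · exact hh.div_const _
    · simp
  · have hsub : uIcc (-T) t ⊆ uIcc (-T) T := by
      rw [uIcc_of_le ht.1, uIcc_of_le hle]; exact Icc_subset_Icc_right ht.2
    have hnext : ∀ x, Φ.duhamelJet T h d (k + 1) x = ∑ l, (d l * Φ.E l (k + 1) x +
        (Φ.E l (k + 1) x * Φ.accum T h x l + Φ.E l k x * (Φ.impulse x l * h x))) := by
      intro x
      have h1 : (if k + 1 = S.natDegree then h x / S.leadingCoeff else 0) =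
          Φ.comb (Φ.impulse x) k x * h x := by
        rw [Φ.comb_impulse x hk]
        split_ifs <;> ring
      rw [duhamelJet, h1, comb_apply, comb_apply, Finset.sum_mul, ← Finset.sum_add_distrib]
      refine Finset.sum_congr rfl fun l _ => ?_
      rw [Pi.add_apply]
      ring
    have hi1 : ∀ l, IntervalIntegrable (fun x => d l * Φ.E l (k + 1) x) volume (-T) t := fun l =>
      (((Φ.isSmoothJet l).continuous (k + 1)).intervalIntegrable _ _).const_mul _
    have hi2 : ∀ l, IntervalIntegrable (fun x => Φ.E l (k + 1) x * Φ.accum T h x l +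
        Φ.E l k x * (Φ.impulse x l * h x)) volume (-T) t := by
      intro l
      refine IntervalIntegrable.add ?_ ?_
      · exact (((Φ.isSmoothJet l).continuous (k + 1)).continuousOn.mul
          ((continuousOn_accum hh l).mono hsub)).intervalIntegrable
      · exact ((intervalIntegrable_impulse_mul hh l).mono_set hsub).continuousOn_mul
          ((Φ.isSmoothJet l).continuous k).continuousOn
    simp only [hnext]
    rw [intervalIntegral.integral_finsetSum fun l _ => (hi1 l).add (hi2 l), duhamelJet_of_lt hk,
      duhamelJet_of_lt hk, comb_apply, comb_apply, ← Finset.sum_add_distrib]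
    refine Finset.sum_congr rfl fun l _ => ?_
    have h0 : Φ.accum T h (-T) l = 0 := intervalIntegral.integral_same
    have hsm := (Φ.isSmoothJet l).isJet T (k + 1)
    have hprod : Φ.E l k t * Φ.accum T h t l = ∫ x in (-T)..t,
        (Φ.E l (k + 1) x * Φ.accum T h x l + Φ.E l k x * (Φ.impulse x l * h x)) :=
      mul_integral_eq_integral (Φ.isSmoothJet l k) ((Φ.isSmoothJet l).continuous (k + 1))
        ((intervalIntegrable_impulse_mul hh l).mono_set hsub)
    rw [intervalIntegral.integral_add (hi1 l) (hi2 l), intervalIntegral.integral_const_mul,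
      ← hprod]
    simp only [Pi.add_apply]
    rw [h0, hsm.eq_integral k (Nat.lt_succ_self k) t ht]
    ring

theorem aeval_duhamelJet (hS : S ≠ 0) (t : ℝ) :
    aeval jetShift S (Φ.duhamelJet T h d) 0 t = h t := by
  have h1 := congrFun (congrFun (Φ.aeval_comb (d + Φ.accum T h t)) 0) t
  have hc : S.leadingCoeff ≠ 0 := leadingCoeff_ne_zero.2 hS
  rw [aeval_jetShift_apply le_rfl] at h1 ⊢
  simp only [zero_add, Pi.zero_apply] at h1
  simp only [duhamelJet, zero_add, mul_add, Finset.sum_add_distrib, h1, mul_ite, mul_zero]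
  rw [Finset.sum_ite_eq' (Finset.range (S.natDegree + 1)), if_pos (by simp)]
  rw [coeff_natDegree]
  field_simp

variable {ι : Type} {U : ι → (ℝ → ℝ) → ℝ} {V : ((ℕ → ℝ → ℝ) × (ℕ → ℝ → ℝ)) →ₗ[ℝ] (ι → ℝ)}

theorem apply_duhamelJet (hUV : IsEndJetForm T S.natDegree U V) :
    V (Φ.duhamelJet T h d, Φ.duhamelJet T h d) =
      Φ.bdryMap V d + Φ.rightBdryMap V (Φ.accum T h T) := by
  rw [← apply_comb_comb_add]
  refine hUV.congr _ _ _ _ (fun k hk => ?_) fun k hk => duhamelJet_of_lt hk T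
  rw [duhamelJet_of_lt hk]
  have h0 : Φ.accum T h (-T) = 0 := funext fun l => intervalIntegral.integral_same
  rw [h0, add_zero]

/-- If `S v = h`, `U v = 0` is solvable, then the boundary values accumulated by `h` are those of a
homogeneous solution. -/
theorem exists_bdryMap_eq_of_isODESolution (hT : 0 < T) (hS : S ≠ 0)
    (hUV : IsEndJetForm T S.natDegree U V) (hh : IntervalIntegrable h volume (-T) T) {v : ℝ → ℝ}
    (hv : IsODESolution T S U h v) :
    ∃ e, Φ.rightBdryMap V (Φ.accum T h T) = Φ.bdryMap V e := by
  obtain ⟨hW, heq, hU⟩ := hv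
  have hw := hW.isJet hT
  set w := fun k => iteratedDerivWithin k v (Icc (-T) T) with hwdef
  have hD := isJet_duhamelJet (Φ := Φ) (d := 0) hT hh
  set D := Φ.duhamelJet T h 0 with hDdef
  have hz : IsJet T S.natDegree (w - D) := hw.sub hD hT
  have hv0 : v = w 0 := by simp [hwdef]
  rw [ae_restrict_iff' measurableSet_Icc] at heq
  obtain ⟨c, hc⟩ := Φ.exists_comb_eq_of_isJet hT hS hz (by
    filter_upwards [heq] with t h1 ht
    rw [map_sub, Pi.sub_apply, Pi.sub_apply, hDdef, aeval_duhamelJet hS, ← h1 ht,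
      diffOp_eq_aeval fun _ _ => rfl, sub_self])
  have hl : -T ∈ Icc (-T) T := ⟨le_rfl, by linarith⟩
  have hr : T ∈ Icc (-T) T := ⟨by linarith, le_rfl⟩
  have h1 : V (w, w) = 0 := by
    ext i
    rw [← hUV.apply_eq v w w hw hw (by rw [hv0]) (by rw [hv0]), hU i]
    rfl
  have h2 : V (w - D, w - D) = Φ.bdryMap V c :=
    hUV.congr _ _ _ _ (fun k hk => hc k hk hl) fun k hk => hc k hk hr
  have h3 : V (D, D) = Φ.rightBdryMap V (Φ.accum T h T) := by
    rw [hDdef, apply_duhamelJet hUV, map_zero, zero_add]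
  refine ⟨-c, ?_⟩
  have h4 : (w - D, w - D) = (w, w) - (D, D) := rfl
  rw [h4, map_sub, h1, h3, zero_sub] at h2
  rw [map_neg, ← h2, neg_neg]

/-- If `S v = h`, `U v = 0` is solvable for all integrable `h`, the boundary values of the impulses
can be compensated by homogeneous solutions: a continuous function that vanishes when integrated
against every `h` is zero. -/
theorem rightBdryMap_impulse_mem_range (hT : 0 < T) (hS : S ≠ 0)
    (hUV : IsEndJetForm T S.natDegree U V) {Λ : (ι → ℝ) →ₗ[ℝ] (Fin S.natDegree → ℝ)}
    (hΛ : Λ ∘ₗ Φ.bdryMap V = LinearMap.id)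
    (hsolv : ∀ h : ℝ → ℝ, IntegrableOn h (Icc (-T) T) → ∃ v, IsODESolution T S U h v)
    {s : ℝ} (hs : s ∈ Icc (-T) T) :
    Φ.bdryMap V (Λ (Φ.rightBdryMap V (Φ.impulse s))) = Φ.rightBdryMap V (Φ.impulse s) := by
  have hlt : -T < T := by linarith
  ext i
  let Ψ : (Fin S.natDegree → ℝ) →ₗ[ℝ] ℝ := LinearMap.proj i ∘ₗ
    ((Φ.bdryMap V ∘ₗ Λ) ∘ₗ Φ.rightBdryMap V - Φ.rightBdryMap V)
  have hΨ : ∀ x, Ψ x = Φ.bdryMap V (Λ (Φ.rightBdryMap V x)) i - Φ.rightBdryMap V x i :=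
    fun _ => rfl
  have hcont : Continuous fun s => Ψ (Φ.impulse s) :=
    (LinearMap.continuous_of_finiteDimensional Ψ).comp Φ.continuous_impulse
  have hint : IntervalIntegrable (fun s => Ψ (Φ.impulse s)) volume (-T) T :=
    hcont.intervalIntegrable _ _
  obtain ⟨v, hv⟩ := hsolv _ hcont.continuousOn.integrableOn_Icc
  obtain ⟨e, he⟩ := exists_bdryMap_eq_of_isODESolution (Φ := Φ) hT hS hUV hint hv
  have h0 : Ψ (Φ.accum T (fun s => Ψ (Φ.impulse s)) T) = 0 := by
    have h1 : Λ (Φ.bdryMap V e) = e := LinearMap.congr_fun hΛ e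
    rw [hΨ, he, h1, sub_self]
  have h1 : ∫ s in (-T)..T, Ψ (Φ.impulse s) * Ψ (Φ.impulse s) = 0 := by
    rw [← LinearMap.integral_coord_mul Ψ Φ.continuous_impulse hint]
    exact h0
  by_contra hne
  have hpos := intervalIntegral.integral_pos hlt (hcont.mul hcont).continuousOn
    (fun x _ => mul_self_nonneg _) ⟨s, hs, mul_self_pos.2 (by
      change Ψ (Φ.impulse s) ≠ 0
      rw [hΨ]
      exact sub_ne_zero.2 hne)⟩
  exact hpos.ne' h1

end FundamentalSystem

/-! ### Integration against the Green's function -/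

theorem integral_ite_lt {a b t : ℝ} {f : ℝ → ℝ} (hf : IntervalIntegrable f volume a b)
    (ht : t ∈ Icc a b) :
    IntervalIntegrable (fun s => if s < t then f s else 0) volume a b ∧
      ∫ s in a..b, (if s < t then f s else 0) = ∫ s in a..t, f s := by
  have hab : a ≤ b := ht.1.trans ht.2
  have hae : (fun s => if s < t then f s else 0) =ᵐ[volume] indicator {x | x ≤ t} f := by
    have h1 : ∀ᵐ s : ℝ, s ≠ t := by simp [ae_iff, measure_singleton]
    filter_upwards [h1] with s hs
    by_cases h : s < t
    · rw [if_pos h, indicator_of_mem (by exact h.le)]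
    · rw [if_neg h, indicator_of_notMem]
      exact fun h' => h (lt_of_le_of_ne h' hs)
  constructor
  · rw [intervalIntegrable_iff_integrableOn_Ioc_of_le hab] at hf ⊢
    exact (hf.indicator measurableSet_Iic).congr (ae_restrict_of_ae hae.symm)
  · rw [← intervalIntegral.integral_indicator ht]
    exact intervalIntegral.integral_congr_ae (hae.mono fun s hs _ => hs)

theorem ae_ne_real (a : ℝ) : ∀ᵐ s : ℝ, s ≠ a := by simp [ae_iff, measure_singleton]

namespace FundamentalSystem

variable {S : ℝ[X]} {Φ : FundamentalSystem S} {T : ℝ} {h : ℝ → ℝ}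
  {c : ℝ → Fin S.natDegree → ℝ}

theorem integral_kernelJet_mul (hc : Continuous c) (hh : IntervalIntegrable h volume (-T) T)
    {t : ℝ} (ht : t ∈ Icc (-T) T) (k : ℕ) :
    IntervalIntegrable (fun s => Φ.kernelJet c s k t * h s) volume (-T) T ∧
      ∫ s in (-T)..T, Φ.kernelJet c s k t * h s =
        Φ.comb ((fun l => ∫ s in (-T)..T, c s l * h s) + Φ.accum T h t) k t := by
  have h1 : ∀ l, IntervalIntegrable (fun s => c s l * h s) volume (-T) T := fun l =>
    intervalIntegrable_coord_mul hc hh l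
  have h2 := fun l => integral_ite_lt (intervalIntegrable_impulse_mul (Φ := Φ) hh l) ht
  have heq : ∀ s, Φ.kernelJet c s k t * h s = ∑ l, (c s l * h s +
      if s < t then Φ.impulse s l * h s else 0) * Φ.E l k t := by
    intro s
    rw [kernelJet]
    by_cases hst : s < t
    · rw [glueJet_of_lt hst, comb_apply, Finset.sum_mul]
      refine Finset.sum_congr rfl fun l _ => ?_
      rw [if_pos hst, Pi.add_apply]
      ring
    · rw [glueJet_of_le (not_lt.1 hst), comb_apply, Finset.sum_mul]
      refine Finset.sum_congr rfl fun l _ => ?_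
      rw [if_neg hst]
      ring
  have hi : ∀ l, IntervalIntegrable (fun s => (c s l * h s +
      if s < t then Φ.impulse s l * h s else 0) * Φ.E l k t) volume (-T) T := fun l =>
    ((h1 l).add (h2 l).1).mul_const _
  simp only [heq]
  refine ⟨?_, ?_⟩
  · have h3 := IntervalIntegrable.sum Finset.univ fun l _ => hi l
    rwa [Finset.sum_fn] at h3
  · rw [intervalIntegral.integral_finsetSum fun l _ => hi l, comb_apply]
    refine Finset.sum_congr rfl fun l _ => ?_
    rw [intervalIntegral.integral_mul_const, intervalIntegral.integral_add (h1 l) (h2 l).1,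
      (h2 l).2]
    rfl

theorem integral_aeval_kernelJet_mul (hc : Continuous c)
    (hh : IntervalIntegrable h volume (-T) T) {t : ℝ} (ht : t ∈ Icc (-T) T) {A : ℝ[X]}
    (hA : A.natDegree < S.natDegree) :
    IntervalIntegrable (fun s => aeval jetShift A (Φ.kernelJet c s) 0 t * h s) volume (-T) T ∧
      ∫ s in (-T)..T, aeval jetShift A (Φ.kernelJet c s) 0 t * h s =
        aeval jetShift A (Φ.duhamelJet T h fun l => ∫ s in (-T)..T, c s l * h s) 0 t := by
  have hk := fun k => integral_kernelJet_mul (Φ := Φ) hc hh ht k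
  have heq : ∀ s, aeval jetShift A (Φ.kernelJet c s) 0 t * h s =
      ∑ k ∈ Finset.range (A.natDegree + 1), A.coeff k * (Φ.kernelJet c s k t * h s) := by
    intro s
    rw [aeval_jetShift_apply le_rfl, Finset.sum_mul]
    exact Finset.sum_congr rfl fun k _ => by rw [zero_add, mul_assoc]
  simp only [heq]
  refine ⟨?_, ?_⟩
  · have h3 := IntervalIntegrable.sum (Finset.range (A.natDegree + 1))
      fun k _ => (hk k).1.const_mul (A.coeff k)
    rwa [Finset.sum_fn] at h3
  · rw [intervalIntegral.integral_finsetSum fun k _ => (hk k).1.const_mul (A.coeff k),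
      aeval_jetShift_apply le_rfl]
    refine Finset.sum_congr rfl fun k hkA => ?_
    rw [intervalIntegral.integral_const_mul, (hk k).2, zero_add,
      duhamelJet_of_lt (by simp at hkA; omega)]

/-- The kernel of `φ^* A(D) + B(D)` applied to a Green's function, integrated against `h`. -/
theorem integral_reflOp_mul (hT : 0 < T) (hc : Continuous c)
    (hh : IntervalIntegrable h volume (-T) T) {G : ℝ → ℝ → ℝ}
    (hG : ∀ s ∈ Ioo (-T) T, ∀ t ∈ Icc (-T) T, t ≠ s → G t s = Φ.kernelJet c s 0 t)
    {t : ℝ} (ht : t ∈ Icc (-T) T) {A B : ℝ[X]}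
    (hA : A.natDegree < S.natDegree) (hB : B.natDegree < S.natDegree) :
    IntervalIntegrable (fun s => reflOp T A B (fun r => G r s) t * h s) volume (-T) T ∧
      ∫ s in (-T)..T, reflOp T A B (fun r => G r s) t * h s =
        reflJet A B (Φ.duhamelJet T h fun l => ∫ s in (-T)..T, c s l * h s) 0 t := by
  have hle : -T ≤ T := by linarith
  have hI := uniqueDiffOn_symm_Icc hT
  have hder : ∀ s ∈ Ioo (-T) T, ∀ t ∈ Icc (-T) T, t ≠ s → ∀ k,
      iteratedDerivWithin k (fun r => G r s) (Icc (-T) T) t = Φ.kernelJet c s k t := by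
    intro s hs t ht hts k
    have he : (fun r => G r s) =ᶠ[𝓝[Icc (-T) T] t] Φ.kernelJet c s 0 := by
      filter_upwards [self_mem_nhdsWithin,
        nhdsWithin_le_nhds (isOpen_compl_singleton.mem_nhds hts)] with r hr hrs
      exact hG s hs r hr hrs
    rw [he.iteratedDerivWithin_eq (he.eq_of_nhdsWithin ht)]
    exact iteratedDerivWithin_glueJet_of_ne hI (Φ.isSmoothJet_comb _) (Φ.isSmoothJet_comb _) ht
      hts k
  have h1 := integral_aeval_kernelJet_mul (Φ := Φ) hc hh (neg_mem_symm_Icc ht) hA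
  have h2 := integral_aeval_kernelJet_mul (Φ := Φ) hc hh ht hB
  have hae : ∀ᵐ s, s ∈ uIoc (-T) T →
      aeval jetShift A (Φ.kernelJet c s) 0 (-t) * h s + aeval jetShift B (Φ.kernelJet c s) 0 t * h s
        = reflOp T A B (fun r => G r s) t * h s := by
    filter_upwards [ae_ne_real T, ae_ne_real t, ae_ne_real (-t)] with s hsT hst hst' hs
    rw [uIoc_of_le hle] at hs
    have hs' : s ∈ Ioo (-T) T := ⟨hs.1, lt_of_le_of_ne hs.2 hsT⟩
    rw [reflOp, diffOp_eq_aeval fun k _ => hder s hs' (-t) (neg_mem_symm_Icc ht) hst'.symm k,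
      diffOp_eq_aeval fun k _ => hder s hs' t ht hst.symm k, add_mul]
  refine ⟨(h1.1.add h2.1).congr_ae ((ae_restrict_iff' measurableSet_uIoc).2 hae), ?_⟩
  rw [← intervalIntegral.integral_congr_ae hae, intervalIntegral.integral_add h1.1 h2.1, h1.2,
    h2.2, reflJet_apply_zero]

variable {ι : Type} {U : ι → (ℝ → ℝ) → ℝ} {V : ((ℕ → ℝ → ℝ) × (ℕ → ℝ → ℝ)) →ₗ[ℝ] (ι → ℝ)}

/-- When the coordinates `c s` balance the boundary values of the impulse at `s`, the superposition
of the kernels satisfies the boundary conditions. -/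
theorem apply_duhamelJet_eq_zero (hT : 0 < T) (hUV : IsEndJetForm T S.natDegree U V)
    (hc : Continuous c) (hh : IntervalIntegrable h volume (-T) T)
    (hcV : ∀ s ∈ Ioo (-T) T, Φ.bdryMap V (c s) = -Φ.rightBdryMap V (Φ.impulse s)) :
    V (Φ.duhamelJet T h fun l => ∫ s in (-T)..T, c s l * h s,
      Φ.duhamelJet T h fun l => ∫ s in (-T)..T, c s l * h s) = 0 := by
  have hle : -T ≤ T := by linarith
  rw [apply_duhamelJet hUV]
  ext i
  have h1 := LinearMap.integral_coord_mul (LinearMap.proj i ∘ₗ Φ.bdryMap V) hc hh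
  have h2 := LinearMap.integral_coord_mul (LinearMap.proj i ∘ₗ Φ.rightBdryMap V)
    Φ.continuous_impulse hh
  simp only [LinearMap.comp_apply, LinearMap.proj_apply] at h1 h2
  rw [Pi.add_apply, h1]
  have h3 : Φ.rightBdryMap V (Φ.accum T h T) i =
      ∫ s in (-T)..T, Φ.rightBdryMap V (Φ.impulse s) i * h s := h2
  rw [h3, Pi.zero_apply, ← sub_neg_eq_add, sub_eq_zero, ← intervalIntegral.integral_neg]
  refine intervalIntegral.integral_congr_ae ?_
  filter_upwards [ae_ne_real T] with s hsT hs
  rw [uIoc_of_le hle] at hs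
  rw [hcV s ⟨hs.1, lt_of_le_of_ne hs.2 hsT⟩, Pi.neg_apply, neg_mul]

/-- The coordinates of the solution on the left of the diagonal, obtained from a left inverse `Λ` of
the boundary map. -/
noncomputable def greenCoord (Φ : FundamentalSystem S)
    (V : ((ℕ → ℝ → ℝ) × (ℕ → ℝ → ℝ)) →ₗ[ℝ] (ι → ℝ)) (Λ : (ι → ℝ) →ₗ[ℝ] (Fin S.natDegree → ℝ))
    (s : ℝ) : Fin S.natDegree → ℝ :=
  -Λ (Φ.rightBdryMap V (Φ.impulse s))

variable {Λ : (ι → ℝ) →ₗ[ℝ] (Fin S.natDegree → ℝ)}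

theorem continuous_greenCoord : Continuous (Φ.greenCoord V Λ) :=
  ((LinearMap.continuous_of_finiteDimensional (Λ ∘ₗ Φ.rightBdryMap V)).comp
    Φ.continuous_impulse).neg

theorem isGreenFunction_greenCoord (hT : 0 < T) (hS : 0 < S.natDegree)
    (hUV : IsEndJetForm T S.natDegree U V)
    (hΛ : ∀ s ∈ Ioo (-T) T, Φ.bdryMap V (Λ (Φ.rightBdryMap V (Φ.impulse s))) =
      Φ.rightBdryMap V (Φ.impulse s)) :
    IsGreenFunction T S U fun t s => Φ.kernelJet (Φ.greenCoord V Λ) s 0 t :=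
  isGreenFunction_kernelJet hT hS hUV continuous_greenCoord fun s hs => by
    rw [greenCoord, map_neg, hΛ s hs]

/-- Every Green's function is the explicit one, away from the diagonal. -/
theorem eq_kernelJet_of_isGreenFunction (hT : 0 < T) (hS : 0 < S.natDegree)
    (hUV : IsEndJetForm T S.natDegree U V) (hΛ : Λ ∘ₗ Φ.bdryMap V = LinearMap.id)
    {G : ℝ → ℝ → ℝ} (hG : IsGreenFunction T S U G) {s : ℝ} (hs : s ∈ Ioo (-T) T) :
    Φ.bdryMap V (Φ.greenCoord V Λ s) = -Φ.rightBdryMap V (Φ.impulse s) ∧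
      ∀ t ∈ Icc (-T) T, t ≠ s → G t s = Φ.kernelJet (Φ.greenCoord V Λ) s 0 t := by
  obtain ⟨c, hl, hr, hb⟩ := hG.exists_eq_comb hT hS Φ hUV hs
  have hc : c = Φ.greenCoord V Λ s := by
    have h1 : Λ (Φ.bdryMap V c) = c := LinearMap.congr_fun hΛ c
    rw [greenCoord, ← map_neg, ← hb, h1]
  subst hc
  refine ⟨hb, fun t ht hts => ?_⟩
  rcases lt_or_gt_of_ne hts with h | h
  · rw [hl t ht h, kernelJet, glueJet_of_le h.le]
  · rw [hr t ht h, kernelJet, glueJet_of_lt h]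

end FundamentalSystem

/-! ### Uniqueness for the problem with reflection -/

section ReflectionKernel

variable {T : ℝ} {n : ℕ} {P Q : ℝ[X]}

/-- The jets of order `n` of the solutions of `L u = 0`, where `L = φ^* P(D) + Q(D)`. -/
noncomputable def kernelJets (T : ℝ) (hT : 0 < T) (n : ℕ) (P Q : ℝ[X]) :
    Submodule ℝ (ℕ → ℝ → ℝ) where
  carrier := {w | IsJet T n w ∧ ∀ᵐ t, t ∈ Icc (-T) T → reflJet P Q w 0 t = 0}
  zero_mem' := ⟨IsJet.zero, Eventually.of_forall fun t _ => by rw [map_zero]; rfl⟩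
  add_mem' := fun ha hb => ⟨ha.1.add hb.1 hT, by
    filter_upwards [ha.2, hb.2] with t h1 h2 ht
    rw [map_add, Pi.add_apply, Pi.add_apply, h1 ht, h2 ht, add_zero]⟩
  smul_mem' := fun c _ ha => ⟨ha.1.smul c, by
    filter_upwards [ha.2] with t h1 ht
    rw [map_smul, Pi.smul_apply, Pi.smul_apply, h1 ht, smul_zero]⟩

/-- The equations `L u = 0` at `t` and at `-t`, solved for the derivative of order `n` at `t`. -/
theorem top_eq_of_reflJet_eq_zero (hP : P.natDegree ≤ n) (hQ : Q.natDegree ≤ n)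
    (hPQ : Q.coeff n ^ 2 ≠ P.coeff n ^ 2) {w : ℕ → ℝ → ℝ} {t : ℝ}
    (h1 : reflJet P Q w 0 t = 0) (h2 : reflJet P Q w 0 (-t) = 0) :
    w n t = ∑ k : Fin n, ((P.coeff n * P.coeff k - Q.coeff n * Q.coeff k) /
        (Q.coeff n ^ 2 - P.coeff n ^ 2) * w k t +
      (P.coeff n * Q.coeff k - Q.coeff n * P.coeff k) /
        (Q.coeff n ^ 2 - P.coeff n ^ 2) * w k (-t)) := by
  have hΔ : Q.coeff n ^ 2 - P.coeff n ^ 2 ≠ 0 := sub_ne_zero.2 hPQ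
  rw [reflJet_apply_zero, aeval_jetShift_apply hP, aeval_jetShift_apply hQ,
    Finset.sum_range_succ, Finset.sum_range_succ] at h1 h2
  simp only [zero_add, neg_neg] at h1 h2
  rw [Finset.sum_range, Finset.sum_range] at h1 h2
  rw [← mul_right_inj' hΔ, Finset.mul_sum]
  have h3 : ∀ k : Fin n, (Q.coeff n ^ 2 - P.coeff n ^ 2) *
      ((P.coeff n * P.coeff k - Q.coeff n * Q.coeff k) /
        (Q.coeff n ^ 2 - P.coeff n ^ 2) * w k t +
      (P.coeff n * Q.coeff k - Q.coeff n * P.coeff k) /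
        (Q.coeff n ^ 2 - P.coeff n ^ 2) * w k (-t)) =
      P.coeff n * (P.coeff k * w k t) - Q.coeff n * (Q.coeff k * w k t) +
        (P.coeff n * (Q.coeff k * w k (-t)) - Q.coeff n * (P.coeff k * w k (-t))) := by
    intro k
    field_simp
  simp only [h3, Finset.sum_add_distrib, Finset.sum_sub_distrib, ← Finset.mul_sum]
  linear_combination Q.coeff n * h1 - P.coeff n * h2

/-- A solution of `L u = 0` is determined by its derivatives of order less than `n` at `0`: the
pair `(u(t), u(-t))` solves a linear system of ordinary differential equations. -/
theorem eq_zero_of_mem_kernelJets {hT : 0 < T} (hP : P.natDegree ≤ n) (hQ : Q.natDegree ≤ n)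
    (hPQ : Q.coeff n ^ 2 ≠ P.coeff n ^ 2) {w : ℕ → ℝ → ℝ} (hw : w ∈ kernelJets T hT n P Q)
    (h0 : ∀ k < n, w k 0 = 0) {k : ℕ} (hk : k < n) {t : ℝ} (ht : t ∈ Icc (-T) T) :
    w k t = 0 := by
  obtain ⟨hj, heq⟩ := hw
  set x : Fin n ⊕ Fin n → ℝ → ℝ := Sum.elim (fun k t => w k t) (fun k t => w k (-t)) with hx
  set A : Fin n ⊕ Fin n → ℝ := Sum.elim
    (fun k => (P.coeff n * P.coeff k - Q.coeff n * Q.coeff k) / (Q.coeff n ^ 2 - P.coeff n ^ 2))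
    (fun k => (P.coeff n * Q.coeff k - Q.coeff n * P.coeff k) / (Q.coeff n ^ 2 - P.coeff n ^ 2))
    with hA
  have htop : ∀ᵐ t, t ∈ Icc (-T) T → w n t = ∑ i, A i * x i t := by
    filter_upwards [heq, ae_comp_neg heq] with t h1 h2 ht
    rw [top_eq_of_reflJet_eq_zero hP hQ hPQ (h1 ht) (h2 ht), Finset.sum_add_distrib,
      Fintype.sum_sum_type]
    rfl
  have hcont : ContinuousOn (fun t => ∑ i, A i * x i t) (Icc (-T) T) := by
    refine continuousOn_finsetSum _ fun i _ => continuousOn_const.mul ?_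
    rcases i with k | k
    · exact hj.continuousOn hT k.2
    · exact (hj.continuousOn hT k.2).comp continuous_neg.continuousOn
        fun t ht => neg_mem_symm_Icc ht
  -- the derivatives of order less than `n`, as classical derivatives
  have hder : ∀ k : Fin n, ∃ B : Fin n ⊕ Fin n → ℝ, ∀ t ∈ Ioo (-T) T,
      HasDerivAt (w k) (∑ i, B i * x i t) t := by
    intro k
    by_cases hk : (k : ℕ) + 1 < n
    · refine ⟨Pi.single (Sum.inl ⟨k + 1, hk⟩) 1, fun t ht => ?_⟩
      have h1 := (hj.hasDerivWithinAt hT hk (Ioo_subset_Icc_self ht)).hasDerivAt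
        (Icc_mem_nhds ht.1 ht.2)
      simpa [Pi.single_apply, hx] using h1
    · refine ⟨A, fun t ht => ?_⟩
      refine (hj.hasDerivWithinAt_of_continuousOn hT k.2 hcont ?_
        (Ioo_subset_Icc_self ht)).hasDerivAt (Icc_mem_nhds ht.1 ht.2)
      rwa [show (k : ℕ) + 1 = n by omega]
  have hswap : ∀ (B : Fin n ⊕ Fin n → ℝ) t, ∑ i, B i * x i (-t) = ∑ i, B i.swap * x i t := by
    intro B t
    rw [Fintype.sum_sum_type, Fintype.sum_sum_type, add_comm]
    simp [hx]
  have key := eq_zero_of_linear_system (t₀ := 0) (a := -T) (b := T) (x := x)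
    ⟨by linarith, hT⟩ (by
      rintro (k | k)
      · exact hder k
      · obtain ⟨B, hB⟩ := hder k
        refine ⟨fun i => -B i.swap, fun t ht => ?_⟩
        have h1 := (hB (-t) ⟨by linarith [ht.2], by linarith [ht.1]⟩).comp t (hasDerivAt_neg t)
        rw [hswap, mul_neg_one, ← Finset.sum_neg_distrib] at h1
        simp only [neg_mul]
        exact h1)
    (by rintro (k | k) <;> simp [hx, h0 k k.2]) (Sum.inl ⟨k, hk⟩)
  have hE : EqOn (w k) 0 (Icc (-T) T) :=
    EqOn.of_subset_closure (s := Ioo (-T) T) (fun t ht => key t ht) (hj.continuousOn hT hk)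
      continuousOn_const Ioo_subset_Icc_self (by rw [closure_Ioo (by linarith)])
  exact hE ht

variable {α β : Fin n → Fin n → ℝ}

/-- Linearly independent two-point conditions take all values on end data. -/
theorem exists_end_data (hB : LinearIndependent ℝ fun k => (α k, β k)) (η : Fin n → ℝ) :
    ∃ x y : Fin n → ℝ, ∀ k, ∑ j, (α k j * x j + β k j * y j) = η k := by
  classical
  let Λ : ((Fin n → ℝ) × (Fin n → ℝ)) →ₗ[ℝ] (Fin n → ℝ) :=
    LinearMap.coprod (Matrix.of α).mulVecLin (Matrix.of β).mulVecLin
  have hΛ : ∀ p k, Λ p k = ∑ j, (α k j * p.1 j + β k j * p.2 j) := fun p k => by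
    simp [Λ, Matrix.mulVec, dotProduct, Finset.sum_add_distrib]
  have hsurj : LinearMap.range Λ = ⊤ := by
    by_contra hne
    obtain ⟨f, hf, hle⟩ := Submodule.exists_le_ker_of_lt_top _ (lt_top_iff_ne_top.2 hne)
    refine hf ?_
    have hfv := LinearMap.apply_eq_sum_single f
    have h0 : ∀ p, ∑ k, Λ p k * f (Pi.single k 1) = 0 := fun p => by
      rw [← hfv]
      exact hle ⟨p, rfl⟩
    have hz := Fintype.linearIndependent_iff.1 hB (fun k => f (Pi.single k 1)) (by
      ext j
      · have := h0 (Pi.single j 1, 0)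
        simp only [hΛ] at this
        simpa [Pi.single_apply, mul_comm, Prod.fst_sum] using this
      · have := h0 (0, Pi.single j 1)
        simp only [hΛ] at this
        simpa [Pi.single_apply, mul_comm, Prod.snd_sum] using this)
    ext v
    rw [LinearMap.comp_apply, LinearMap.single_apply, hz]
    rfl
  obtain ⟨p, hp⟩ := LinearMap.range_eq_top.1 hsurj η
  exact ⟨p.1, p.2, fun k => by rw [← hp, hΛ]⟩

theorem ContDiff.isSmoothJet {f : ℝ → ℝ} (hf : ∀ m : ℕ, ContDiff ℝ m f) :
    IsSmoothJet fun k => iteratedDeriv k f := by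
  intro k t
  have h := (hf (k + 1)).differentiable_iteratedDeriv k (by exact_mod_cast Nat.lt_succ_self k)
  simp only [iteratedDeriv_succ]
  exact (h t).hasDerivAt

/-- Smooth functions with prescribed values of the boundary conditions: prescribe the derivatives at
both end points and join the two pieces by a cutoff. -/
theorem exists_smooth_bdryJet_eq (hT : 0 < T) {S : ℝ[X]} (hnS : n ≤ S.natDegree)
    (Φ : FundamentalSystem S) (hB : LinearIndependent ℝ fun k => (α k, β k)) (η : Fin n → ℝ) :
    ∃ w : ℕ → ℝ → ℝ, IsSmoothJet w ∧ bdryJet T α β (w, w) = η := by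
  obtain ⟨x, y, hxy⟩ := exists_end_data hB η
  have hdata : ∀ (x : Fin n → ℝ) (s : ℝ), ∃ c, ∀ k : Fin n, Φ.comb c k s = x k := by
    intro x s
    refine ⟨_, fun k => (Φ.comb_initial (fun i => if h : (i : ℕ) < n then x ⟨i, h⟩ else 0) s
      ⟨k, k.2.trans_le hnS⟩).trans ?_⟩
    simp
  obtain ⟨c, hc⟩ := hdata x (-T)
  obtain ⟨d, hd⟩ := hdata y T
  set p := Φ.comb c
  set q := Φ.comb d
  have hp : IsSmoothJet p := Φ.isSmoothJet_comb c
  have hq : IsSmoothJet q := Φ.isSmoothJet_comb d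
  set f : ℝ → ℝ := fun t => p 0 t + Real.smoothTransition (2 * t / T) * (q 0 t - p 0 t) with hf
  have hfl : ∀ t ≤ 0, f t = p 0 t := fun t ht => by
    have h1 : Real.smoothTransition (2 * t / T) = 0 :=
      Real.smoothTransition.zero_of_nonpos (div_nonpos_of_nonpos_of_nonneg (by linarith) hT.le)
    simp only [hf, h1]
    ring
  have hfr : ∀ t, T / 2 ≤ t → f t = q 0 t := fun t ht => by
    have h1 : Real.smoothTransition (2 * t / T) = 1 :=
      Real.smoothTransition.one_of_one_le ((one_le_div hT).2 (by linarith))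
    simp only [hf, h1]
    ring
  have hfs : ∀ m : ℕ, ContDiff ℝ m f := fun m => by
    have h1 : ContDiff ℝ m fun t => Real.smoothTransition (2 * t / T) :=
      Real.smoothTransition.contDiff.comp (by fun_prop)
    exact (hp.contDiff m).add (h1.mul ((hq.contDiff m).sub (hp.contDiff m)))
  have hw := ContDiff.isSmoothJet hfs
  refine ⟨_, hw, ?_⟩
  have hl : f =ᶠ[𝓝[Icc (-T) T] (-T)] p 0 := by
    filter_upwards [nhdsWithin_le_nhds (Iio_mem_nhds (show -T < 0 by linarith))] with t ht
    exact hfl t (le_of_lt ht)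
  have hr : f =ᶠ[𝓝[Icc (-T) T] T] q 0 := by
    filter_upwards [nhdsWithin_le_nhds (Ioi_mem_nhds (show T / 2 < T by linarith))] with t ht
    exact hfr t (le_of_lt ht)
  ext k
  rw [← bdryOp_eq hT (hw.isJet T n) (hw.isJet T n) (v := f) (by rw [iteratedDeriv_zero]) (by rw [iteratedDeriv_zero]),
    bdryOp_eq hT (hp.isJet T n) (hq.isJet T n) hl hr, bdryJet_apply, ← hxy k]
  refine Finset.sum_congr rfl fun j _ => ?_
  simp only [hc j, hd j]

theorem IsReflSolution.exists_jet (hT : 0 < T) {h u : ℝ → ℝ}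
    (hu : IsReflSolution T P Q α β h u) :
    ∃ w : ℕ → ℝ → ℝ, w 0 = u ∧ IsJet T n w ∧
      (∀ᵐ t, t ∈ Icc (-T) T → reflJet P Q w 0 t = h t) ∧ bdryJet T α β (w, w) = 0 := by
  obtain ⟨hW, heq, hb⟩ := hu
  have hw := hW.isJet hT
  have h0 : (fun k => iteratedDerivWithin k u (Icc (-T) T)) 0 = u := by simp
  refine ⟨_, h0, hw, ?_, ?_⟩
  · rw [ae_restrict_iff' measurableSet_Icc] at heq
    filter_upwards [heq] with t ht htI
    rw [← ht htI, reflOp_eq_reflJet]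
  · ext k
    rw [← bdryOp_eq hT hw hw (v := u) (by rw [iteratedDerivWithin_zero])
      (by rw [iteratedDerivWithin_zero]), hb k]
    rfl

/-- If the problem with reflection is solvable for every `h`, its solutions are unique. The kernel
of `L` embeds in `ℝ^n` through the derivatives at `0`; by solvability the `n` boundary conditions
map it onto `ℝ^n`, hence injectively. -/
theorem eqOn_of_isReflSolution (hT : 0 < T) {S : ℝ[X]} (hnS : n ≤ S.natDegree)
    (Φ : FundamentalSystem S) (hB : LinearIndependent ℝ fun k => (α k, β k))
    (hP : P.natDegree ≤ n) (hQ : Q.natDegree ≤ n) (hPQ : Q.coeff n ^ 2 ≠ P.coeff n ^ 2)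
    (hsolv : ∀ h : ℝ → ℝ, IntegrableOn h (Icc (-T) T) → ∃ u, IsReflSolution T P Q α β h u)
    {h u v : ℝ → ℝ} (hu : IsReflSolution T P Q α β h u) (hv : IsReflSolution T P Q α β h v)
    (hn : 1 ≤ n) : EqOn u v (Icc (-T) T) := by
  let K := kernelJets T hT n P Q
  let ev : K →ₗ[ℝ] (Fin n → ℝ) :=
    { toFun := fun w k => w.1 k 0, map_add' := fun _ _ => rfl, map_smul' := fun _ _ => rfl }
  let B : K →ₗ[ℝ] (Fin n → ℝ) :=
    bdryJet T α β ∘ₗ (LinearMap.prod LinearMap.id LinearMap.id) ∘ₗ K.subtype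
  have hBv : ∀ w : K, B w = bdryJet T α β (w.1, w.1) := fun _ => rfl
  have hev : ∀ w : K, ev w = 0 → ∀ k < n, ∀ t ∈ Icc (-T) T, w.1 k t = 0 := fun w hw k hk t ht =>
    eq_zero_of_mem_kernelJets hP hQ hPQ w.2 (fun j hj => congrFun hw ⟨j, hj⟩) hk ht
  have hevB : ∀ w : K, ev w = 0 → B w = 0 := fun w hw => by
    ext k
    rw [hBv, bdryJet_apply]
    refine Finset.sum_eq_zero fun j _ => ?_
    simp only
    rw [hev w hw j j.2 _ ⟨le_rfl, by linarith⟩, hev w hw j j.2 _ ⟨by linarith, le_rfl⟩]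
    simp
  have hBs : Function.Surjective B := by
    intro η
    obtain ⟨w, hw, hwη⟩ := exists_smooth_bdryJet_eq hT hnS Φ hB η
    have hcont : Continuous (reflJet P Q w 0) := by
      have h1 : ∀ A : ℝ[X], Continuous (aeval jetShift A w 0) := fun A => by
        have : aeval jetShift A w 0 =
            fun t => ∑ k ∈ Finset.range (A.natDegree + 1), A.coeff k * w (0 + k) t :=
          funext fun t => aeval_jetShift_apply le_rfl w 0 t
        rw [this]
        exact continuous_finsetSum _ fun k _ => continuous_const.mul (hw.continuous _)
      have h2 : reflJet P Q w 0 = fun t => aeval jetShift P w 0 (-t) + aeval jetShift Q w 0 t :=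
        funext fun t => reflJet_apply_zero P Q w t
      rw [h2]
      exact ((h1 P).comp continuous_neg).add (h1 Q)
    obtain ⟨u₀, hu₀⟩ := hsolv _ (hcont.continuousOn.integrableOn_Icc)
    obtain ⟨z, -, hz, hzeq, hzb⟩ := hu₀.exists_jet hT
    refine ⟨⟨w - z, ?_, ?_⟩, ?_⟩
    · exact (hw.isJet T n).sub hz hT
    · filter_upwards [hzeq] with t h1 ht
      rw [map_sub, Pi.sub_apply, Pi.sub_apply, h1 ht, sub_self]
    · rw [hBv]
      change bdryJet T α β ((w, w) - (z, z)) = η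
      rw [map_sub, hwη, hzb, sub_zero]
  obtain ⟨σ, hσ⟩ := B.exists_rightInverse_of_surjective (LinearMap.range_eq_top.2 hBs)
  have hσ' : ∀ x, B (σ x) = x := fun x => LinearMap.congr_fun hσ x
  have hinj : Function.Injective (ev ∘ₗ σ) := by
    rw [injective_iff_map_eq_zero]
    intro x hx
    rw [← hσ' x, hevB _ hx]
  have hsurj := LinearMap.injective_iff_surjective.1 hinj
  obtain ⟨w, hw0, hw, hweq, hwb⟩ := hu.exists_jet hT
  obtain ⟨z, hz0, hz, hzeq, hzb⟩ := hv.exists_jet hT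
  have hwz : w - z ∈ K := by
    refine ⟨hw.sub hz hT, ?_⟩
    filter_upwards [hweq, hzeq] with t h1 h2 ht
    rw [map_sub, Pi.sub_apply, Pi.sub_apply, h1 ht, h2 ht, sub_self]
  have hBwz : B ⟨w - z, hwz⟩ = 0 := by
    rw [hBv]
    change bdryJet T α β ((w, w) - (z, z)) = 0
    rw [map_sub, hwb, hzb, sub_zero]
  obtain ⟨x, hx⟩ := hsurj (ev ⟨w - z, hwz⟩)
  have h1 : ev (σ x - ⟨w - z, hwz⟩) = 0 := by
    rw [map_sub, sub_eq_zero]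
    exact hx
  have h2 := hevB _ h1
  rw [map_sub, hσ', hBwz, sub_zero] at h2
  rw [h2, map_zero] at hx
  intro t ht
  have h3 := hev ⟨w - z, hwz⟩ hx.symm 0 hn t ht
  have h4 : w 0 t - z 0 t = 0 := h3
  rw [hw0, hz0] at h4
  linarith

end ReflectionKernel

theorem isEndJetForm_reducedBdry {T : ℝ} (hT : 0 < T) {n l : ℕ} (hn : 1 ≤ n)
    {α β : Fin n → Fin n → ℝ} {P' Q' : ℝ[X]} (hP' : P'.natDegree ≤ l) (hQ' : Q'.natDegree ≤ l) :
    IsEndJetForm T (n + l) (reducedBdry T P' Q' α β) (reducedJet T α β P' Q') where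
  apply_eq _ _ _ hf hg hvf hvg i := reducedBdry_eq hT hn hP' hQ' hf hg hvf hvg i
  congr f g f' g' hf hg := by
    have hQ'' : (-(Q'.comp (-X))).natDegree ≤ l := by rwa [natDegree_neg, natDegree_comp_neg_X]
    have ha : ∀ (A : ℝ[X]) (w w' : ℕ → ℝ → ℝ) (t : ℝ), A.natDegree ≤ l →
        (∀ k < n + l, w k t = w' k t) → ∀ j < n,
        aeval jetShift A w j t = aeval jetShift A w' j t := by
      intro A w w' t hA hw j hj
      rw [aeval_jetShift_apply hA, aeval_jetShift_apply hA]
      exact Finset.sum_congr rfl fun k hk => by rw [hw _ (by simp at hk; omega)]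
    ext i
    rcases i with k | k
    · rw [reducedJet_inl, reducedJet_inl, bdryJet_apply, bdryJet_apply]
      refine Finset.sum_congr rfl fun j _ => ?_
      change α k j * f j (-T) + β k j * g j T = α k j * f' j (-T) + β k j * g' j T
      rw [hf j (by omega), hg j (by omega)]
    · rw [reducedJet_inr, reducedJet_inr, bdryJet_apply, bdryJet_apply]
      refine Finset.sum_congr rfl fun j _ => ?_
      simp only [endReflJet, LinearMap.coe_mk, AddHom.coe_mk, Pi.add_apply, jetRefl_apply, neg_neg]
      rw [ha _ f f' (-T) hP' hf j j.2, ha _ g g' T hP' hg j j.2, ha _ f f' (-T) hQ'' hf j j.2,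
        ha _ g g' T hQ'' hg j j.2]

/-- If `w` is the jet of a solution `v` of `S v = h` under the conditions of the reduced problem,
then `L̂ v` solves `L u = h`, `B_k u = 0`. -/
theorem isReflSolution_hat {T : ℝ} (hT : 0 < T) {n l : ℕ} {P Q R P' Q' : ℝ[X]}
    (hR : R.comp (-X) = R) (hP' : P = R * P') (hQ' : Q = R * Q') (hP : P.natDegree ≤ n)
    (hQ : Q.natDegree ≤ n) (hPl : P'.natDegree ≤ l) (hQl : Q'.natDegree ≤ l)
    {α β : Fin n → Fin n → ℝ} {h u : ℝ → ℝ} {w : ℕ → ℝ → ℝ} (hw : IsJet T (n + l) w)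
    (heq : ∀ t, aeval jetShift (reducedPoly P Q P' Q') w 0 t = h t)
    (hb : reducedJet T α β P' Q' (w, w) = 0)
    (hu : EqOn u (reflJet P' (-(Q'.comp (-X))) w 0) (Icc (-T) T)) :
    IsReflSolution T P Q α β h u := by
  have hQl' : (-(Q'.comp (-X))).natDegree ≤ l := by rwa [natDegree_neg, natDegree_comp_neg_X]
  have hj : IsJet T n (reflJet P' (-(Q'.comp (-X))) w) := IsJet.reflJet_of_le hT hw hPl hQl'
  refine ⟨hj.memW hT hu, ?_, fun k => ?_⟩
  · rw [ae_restrict_iff' measurableSet_Icc]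
    filter_upwards [hj.ae_reflOp_eq hT hu hP hQ] with t h1 ht
    rw [h1 ht, ← Module.End.mul_apply, reflJet_mul_hat hR hP' hQ', heq]
  · have hue : ∀ a, u =ᶠ[𝓝[Icc (-T) T] a] reflJet P' (-(Q'.comp (-X))) w 0 := fun a =>
      hu.eventuallyEq_nhdsWithin
    rw [bdryOp_eq hT hj hj (hue _) (hue _)]
    exact congrFun hb (Sum.inr k)

/-! ### The reduction theorem -/

theorem mainTheorem11 (T : ℝ) (hT : 0 < T) (n : ℕ) (hn : 1 ≤ n)
    (P Q : ℝ[X]) (hP : P.natDegree ≤ n) (hQ : Q.natDegree ≤ n)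
    (hPQ : Q.coeff n ^ 2 ≠ P.coeff n ^ 2)
    (α β : Fin n → Fin n → ℝ) (hB : LinearIndependent ℝ fun k => (α k, β k))
    (R P' Q' : ℝ[X]) (hR : R.comp (-X) = R) (hP' : P = R * P') (hQ' : Q = R * Q') :
    ∃ S : ℝ[X],
      -- `L̂ L = S = L L̂`
      (∀ u : ℝ → ℝ, MemW T (n + max P'.natDegree Q'.natDegree) u →
        ∀ᵐ t ∂volume.restrict (Icc (-T) T),
          hatOp T P' Q' (reflOp T P Q u) t = diffOp T S u t ∧
          reflOp T P Q (hatOp T P' Q' u) t = diffOp T S u t) ∧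
      -- if `S v = 0`, `B_k L̂ v = 0`, `B_k v = 0` has the unique solution `v = 0`:
      ((∀ v : ℝ → ℝ, IsODESolution T S (reducedBdry T P' Q' α β) 0 v →
          EqOn v 0 (Icc (-T) T)) →
        -- existence of the Green's function
        ((R.natDegree = 0 ∨ ∀ h : ℝ → ℝ, IntegrableOn h (Icc (-T) T) →
            ∃ v, IsODESolution T S (reducedBdry T P' Q' α β) h v) →
          ∃ G, IsGreenFunction T S (reducedBdry T P' Q' α β) G) ∧
        -- its uniqueness off the diagonal
        (∀ G₁ G₂, IsGreenFunction T S (reducedBdry T P' Q' α β) G₁ →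
          IsGreenFunction T S (reducedBdry T P' Q' α β) G₂ →
          ∀ s ∈ Ioo (-T) T, ∀ t ∈ Icc (-T) T, t ≠ s → G₁ t s = G₂ t s) ∧
        -- the unique solution of `L u = h`, `B_k u = 0`
        ∀ G, IsGreenFunction T S (reducedBdry T P' Q' α β) G →
          ∀ h : ℝ → ℝ, IntegrableOn h (Icc (-T) T) →
            (∀ t ∈ Icc (-T) T, IntervalIntegrable
              (fun s => hatOp T P' Q' (fun r => G r s) t * h s) volume (-T) T) ∧
            IsReflSolution T P Q α β h
              (fun t => ∫ s in (-T)..T, hatOp T P' Q' (fun r => G r s) t * h s) ∧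
            ∀ u, IsReflSolution T P Q α β h u →
              EqOn u (fun t => ∫ s in (-T)..T, hatOp T P' Q' (fun r => G r s) t * h s)
                (Icc (-T) T)) := by
  set l := max P'.natDegree Q'.natDegree with hl
  have hPl : P'.natDegree ≤ l := le_max_left _ _
  have hQl : Q'.natDegree ≤ l := le_max_right _ _
  have hQl' : (-(Q'.comp (-X))).natDegree ≤ l := by rwa [natDegree_neg, natDegree_comp_neg_X]
  have hdeg := natDegree_add_max_eq hP hQ hPQ hP' hQ'
  set S := reducedPoly P Q P' Q' with hSdef
  have hN : S.natDegree = n + l := natDegree_reducedPoly hP hQ hPQ hP' hQ'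
  have hS : 0 < S.natDegree := by omega
  have hS0 : S ≠ 0 := by rintro h; simp [h] at hS
  refine ⟨S, fun u hu => hu.hatOp_reflOp hT hR hP' hQ' hP hQ hPl hQl, fun huniq => ?_⟩
  obtain ⟨Φ⟩ := FundamentalSystem.nonempty hS
  set U := reducedBdry T P' Q' α β
  set V := reducedJet T α β P' Q'
  have hUV : IsEndJetForm T S.natDegree U V := by
    rw [hN]
    exact isEndJetForm_reducedBdry hT hn hPl hQl
  have hinj : Function.Injective (Φ.bdryMap V) := Φ.bdryMap_injective hT hUV huniq
  obtain ⟨Λ, hΛ⟩ := (Φ.bdryMap V).exists_leftInverse_of_injective (LinearMap.ker_eq_bot.2 hinj)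
  have hc : Continuous (Φ.greenCoord V Λ) := FundamentalSystem.continuous_greenCoord
  refine ⟨fun hex => ⟨_, FundamentalSystem.isGreenFunction_greenCoord (Φ := Φ) (Λ := Λ) hT hS hUV
    fun s hs => ?_⟩, fun G₁ G₂ hG₁ hG₂ s hs t ht hts => ?_, fun G hG => ?_⟩
  · rcases hex with hR0 | hsolv
    · -- for constant `R` the equation has order `2 n`, so that the boundary map is onto
      have hcard : Module.finrank ℝ (Fin S.natDegree → ℝ) =
          Module.finrank ℝ (Fin n ⊕ Fin n → ℝ) := by
        rw [Module.finrank_fintype_fun_eq_card, Module.finrank_fintype_fun_eq_card,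
          Fintype.card_sum, Fintype.card_fin, Fintype.card_fin]
        omega
      obtain ⟨c, hc⟩ := (LinearMap.injective_iff_surjective_of_finrank_eq_finrank hcard).1 hinj
        (Φ.rightBdryMap V (Φ.impulse s))
      rw [← hc]
      exact congrArg _ (LinearMap.congr_fun hΛ c)
    · exact FundamentalSystem.rightBdryMap_impulse_mem_range hT hS0 hUV hΛ hsolv
        (Ioo_subset_Icc_self hs)
  · rw [(FundamentalSystem.eq_kernelJet_of_isGreenFunction hT hS hUV hΛ hG₁ hs).2 t ht hts,
      (FundamentalSystem.eq_kernelJet_of_isGreenFunction hT hS hUV hΛ hG₂ hs).2 t ht hts]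
  · have hker := fun s (hs : s ∈ Ioo (-T) T) =>
      FundamentalSystem.eq_kernelJet_of_isGreenFunction hT hS hUV hΛ hG hs
    have hrep : ∀ h : ℝ → ℝ, IntegrableOn h (Icc (-T) T) → ∀ t ∈ Icc (-T) T, _ :=
      fun h hh t ht => FundamentalSystem.integral_reflOp_mul (Φ := Φ) hT hc
        ((intervalIntegrable_iff_integrableOn_Icc_of_le (by linarith)).2 hh)
        (fun s hs => (hker s hs).2) ht (A := P') (B := -(Q'.comp (-X))) (by omega) (by omega)
    have hsol : ∀ h : ℝ → ℝ, IntegrableOn h (Icc (-T) T) → IsReflSolution T P Q α β h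
        fun t => ∫ s in (-T)..T, hatOp T P' Q' (fun r => G r s) t * h s := by
      intro h hh
      have hh' := (intervalIntegrable_iff_integrableOn_Icc_of_le (show -T ≤ T by linarith)).2 hh
      have hj := FundamentalSystem.isJet_duhamelJet (Φ := Φ)
        (d := fun l => ∫ s in (-T)..T, Φ.greenCoord V Λ s l * h s) hT hh'
      exact isReflSolution_hat hT hR hP' hQ' hP hQ hPl hQl (hj.mono hN.ge)
        (fun t => FundamentalSystem.aeval_duhamelJet hS0 t)
        (FundamentalSystem.apply_duhamelJet_eq_zero hT hUV hc hh' fun s hs => (hker s hs).1)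
        (fun t ht => (hrep h hh t ht).2)
    exact fun h hh => ⟨fun t ht => (hrep h hh t ht).1, hsol h hh, fun u hu =>
      eqOn_of_isReflSolution hT (by omega) Φ hB hP hQ hPQ (fun h hh => ⟨_, hsol h hh⟩) hu
        (hsol h hh) hn⟩
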